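/- **Setting.** A (finitary) polynomial endofunctor $P$ over groupoids is a diagram of groupoids $I \xleftarrow{s} E \xrightarrow{p} B \xrightarrow{t} I$ such that all homotopy fibres $E_b$ of $p$ are finite and discrete. A *cartesian morphism* $u\colon P'\Rightarrow P$ consists of functors $I'\to I$, $E'\to E$, $B'\to B$ (all written $u$) and natural isomorphisms filling the three squares between $I'\leftarrow E'\to B'\to I'$ and $I\leftarrow E\to B\to I$, such that the middle square is a homotopy pullback. A (finite rooted) *tree* is a diagram of finite sets $A \xleftarrow{s} M \xrightarrow{p} N \xrightarrow{t} A$ (edges, nodes with a marked input edge, nodes, edges) with $t$ injective, $s$ injective with singleton complement (the root), and such that from every edge one reaches the root by repeatedly replacing $s(m)$ by $t(p(m))$. A *$P$-tree* is such a tree together with maps $A\to I$, $M\to E$, $N\to B$ and specified isomorphisms filling the three squares to $I\leftarrow E\to B\to I$, the middle square being a homotopy pullback; $P$-trees form a groupoid $\mathbf T_P$, and a $P$-forest is a finite family of $P$-trees. Composing diagrams with $u$ turns $P'$-trees into $P$-trees (*redecoration*), and likewise for forests. Let $\mathscr B_P=\mathbb Q[T\in\pi_0\mathbf T_P]$ be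 the free commutative algebra on the isomorphism classes of $P$-trees, with the algebra homomorphisms $\Delta\colon\mathscr B_P\to\mathscr B_P\otimes\mathscr B_P$ and $\varepsilon\colon\mathscr B_P\to\mathbb Q$ given on generators by $$\Delta(T)=\sum_{S\subset T}P_S\otimes S,\qquad \varepsilon(T)=\begin{cases}1&\text{if }T\text{ has no nodes}\\0&\text{otherwise,}\end{cases}$$ where $S$ runs over the subtrees of $T$ containing the root, and $P_S$ is the product, over the leaves $e$ of $S$, of the trees consisting of $e$ and everything above it in $T$. For $b\in B$ and a $P$-forest $F$, a *matching* $\theta$ of $F$ with $b$ is a bijection between the roots of $F$ and $E_b$, together with, for each root, an isomorphism in $I$ from its colour to the colour $s(e)$ of the corresponding $e\in E_b$. Grafting $F$ onto the corolla $b$ along $\theta$ gives a $P$-tree $b_\theta(F)$. Write $\mathrm{Mat}(F,b)$ for the set of matchings. If the hom-sets of $I$ are finite, the *operator* $B_+^b\colon\mathscr B_P\to\mathscr B_P$ is the linear map with $B_+^b(F)=\sum_{\theta\in\mathrm{Mat}(F,b)} b_\theta(F)$ on forests (monomials). **Proposition.** Let $u\colon P'\Rightarrow P$ be a cartesian morphism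 of polynomial endofunctors. Then $(\mathscr B_{P'},\Delta,\varepsilon)$ and $(\mathscr B_P,\Delta,\varepsilon)$ are bialgebras, and there is a bialgebra homomorphism $\varphi\colon\mathscr B_{P'}\to\mathscr B_P$ sending each $P'$-tree to its redecoration. It is compatible with grafting: 1. For all $b'\in B'$, every $P'$-forest $F'$ and every matching $\theta$ of $F'$ with $b'$, with induced matching $u\theta$ of the redecorated forest $uF'$ with $u(b')$, the redecoration of $b'_\theta(F')$ is isomorphic to $u(b')_{u\theta}(uF')$. That is, grafting onto $b'$ followed by redecoration equals redecoration followed by grafting onto $u(b')$. 2. If the functor $I'\to I$ is fully faithful (for instance, the identity of $I'=I$), then $\theta\mapsto u\theta$ is a bijection $\mathrm{Mat}(F',b')\to\mathrm{Mat}(uF',u(b'))$ for all $F'$ and $b'$; consequently, if moreover the hom-sets of $I$ are finite, $\varphi\circ B_+^{b'}=B_+^{u(b')}\circ\varphi$ for all $b'\in B'$. -/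

import Mathlib

open CategoryTheory
open scoped TensorProduct

universe v u v' u'

/-- The set of isomorphism classes of objects of a category. -/
abbrev Pi0 (C : Type u) [Category.{v} C] : Type u := Quotient (isIsomorphicSetoid C)

/-! ### Polynomial endofunctors over groupoids and cartesian morphisms -/

/-- A finitary polynomial endofunctor over groupoids, given by a diagram
`I ← E → B → I` of groupoids in which the middle functor `p` has finite discrete homotopy fibres.
The homotopy fibre of `p` over `b` is `CostructuredArrow p b`: its objects are pairs
`(e, φ : p e ⟶ b)`.  A groupoid is discrete (equivalent to a set) if and only if
it has at most one arrow between any two objects. -/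
structure PolyEndo where
  I : Type u
  E : Type u
  B : Type u
  [groupoidI : Groupoid.{v} I]
  [groupoidE : Groupoid.{v} E]
  [groupoidB : Groupoid.{v} B]
  s : E ⥤ I
  p : E ⥤ B
  t : B ⥤ I
  discrete_fibre : ∀ (b : B) (x y : CostructuredArrow p b), Subsingleton (x ⟶ y)
  finite_fibre : ∀ b : B, Finite (Pi0 (CostructuredArrow p b))

attribute [instance] PolyEndo.groupoidI PolyEndo.groupoidE PolyEndo.groupoidB

namespace PolyEndo

/-- The arity of the operation `b`: the finite set underlying the (discrete) homotopy
fibre `E_b`. -/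
abbrev Arity (P : PolyEndo.{v, u}) (b : P.B) : Type (max u v) :=
  Pi0 (CostructuredArrow P.p b)

/-- The input colour `s(e)` attached to an element `e` of the arity of `b`. -/
noncomputable def inColour (P : PolyEndo.{v, u}) {b : P.B} (x : P.Arity b) : P.I :=
  P.s.obj x.out.left

theorem nonempty_hom_of_mk_eq (P : PolyEndo.{v, u}) {b : P.B} {x y : CostructuredArrow P.p b}
    (h : (Quotient.mk _ x : P.Arity b) = Quotient.mk _ y) : Nonempty (x ⟶ y) :=
  (Quotient.exact h).map Iso.hom

theorem mk_eq_of_hom (P : PolyEndo.{v, u}) {b : P.B} {x y : CostructuredArrow P.p b}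
    (f : x ⟶ y) : (Quotient.mk _ x : P.Arity b) = Quotient.mk _ y :=
  Quotient.sound ⟨CostructuredArrow.isoMk
    ((Groupoid.isoEquivHom _ _).symm f.left) (by simp [Groupoid.isoEquivHom])⟩

end PolyEndo

/-- The functor from the corner of a square commuting up to isomorphism to the
homotopy pullback of the two functors with common target. -/
def pullbackComparison {X Y Z W : Type*} [Category* X] [Category* Y] [Category* Z] [Category* W]
    {f : X ⥤ Y} {g : X ⥤ Z} {h : Y ⥤ W} {k : Z ⥤ W} (γ : f ⋙ h ≅ g ⋙ k) :
    X ⥤ Limits.CategoricalPullback h k where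
  obj x := ⟨f.obj x, g.obj x, γ.app x⟩
  map a := ⟨f.map a, g.map a, γ.hom.naturality a⟩

/-- A cartesian morphism `P' ⇒ P` of polynomial endofunctors: a diagram
```
I' ← E' → B' → I'
↓    ↓    ↓    ↓
I  ← E  → B  → I
```
of groupoids, commuting up to specified isomorphisms, whose middle square is
a homotopy pullback. -/
structure CartMor (P' : PolyEndo.{v', u'}) (P : PolyEndo.{v, u}) where
  onI : P'.I ⥤ P.I
  onE : P'.E ⥤ P.E
  onB : P'.B ⥤ P.B
  sqS : P'.s ⋙ onI ≅ onE ⋙ P.s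
  sqP : onE ⋙ P.p ≅ P'.p ⋙ onB
  sqT : P'.t ⋙ onI ≅ onB ⋙ P.t
  isPullback : (pullbackComparison sqP).IsEquivalence

/-! ### Trees -/

/-- A finite rooted tree: a diagram of finite sets `A ← M → N → A` (edges, nodes with a marked
input edge, nodes, edges) such that `t` is injective, `s` is injective with singleton complement
(the root edge), and walking from any edge `s m` to the edge `t (p m)`
eventually leads to the root. -/
structure OpTree where
  A : Type
  M : Type
  N : Type
  [finA : Finite A]
  [finM : Finite M]
  [finN : Finite N]
  s : M → A
  p : M → N
  t : N → A
  t_injective : Function.Injective t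
  s_injective : Function.Injective s
  root : A
  compl_range_s : (Set.range s)ᶜ = {root}
  walk : ∀ a : A, Relation.ReflTransGen (fun x y => ∃ m, s m = x ∧ t (p m) = y) a root

attribute [instance] OpTree.finA OpTree.finM OpTree.finN

namespace OpTree

/-- One step of the walk towards the root. -/
def Step (T : OpTree) (x y : T.A) : Prop := ∃ m, T.s m = x ∧ T.t (T.p m) = y

theorem s_ne_root (T : OpTree) (m : T.M) : T.s m ≠ T.root := fun h => by
  have : T.root ∈ (Set.range T.s)ᶜ := by rw [T.compl_range_s]; rfl
  exact this ⟨m, h⟩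

theorem exists_s_eq (T : OpTree) {a : T.A} (h : a ≠ T.root) : ∃ m, T.s m = a := by
  by_contra hc
  have : a ∈ (Set.range T.s)ᶜ := hc
  rw [T.compl_range_s] at this
  exact h this

theorem not_transGen_self (T : OpTree) (a : T.A) : ¬ Relation.TransGen T.Step a a := by
  have h := T.walk a
  induction h using Relation.ReflTransGen.head_induction_on with
  | refl =>
    intro h
    obtain ⟨c, ⟨m, hm, -⟩, -⟩ := Relation.TransGen.head'_iff.1 h
    exact T.s_ne_root m hm
  | head hac _ ih =>
    intro h
    obtain ⟨d, ⟨m, hm, hd⟩, hda⟩ := Relation.TransGen.head'_iff.1 h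
    obtain ⟨m', hm', hc⟩ := hac
    obtain rfl := T.s_injective (hm.trans hm'.symm)
    obtain rfl : d = _ := hd.symm.trans hc
    exact ih (Relation.TransGen.tail' hda ⟨m, hm, hd⟩)

/-- A subtree: a set of edges and a set of nodes containing with each node its output edge and all
its input edges, such that each edge of the subtree, except exactly one (its root), is an input
edge of a node of the subtree.  (These are the images of tree embeddings.) -/
@[ext]
structure Subtree (T : OpTree) where
  edges : Set T.A
  nodes : Set T.N
  root : T.A
  root_mem : root ∈ edges
  t_mem : ∀ n ∈ nodes, T.t n ∈ edges
  image_s : T.s '' (T.p ⁻¹' nodes) = edges \ {root}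

namespace Subtree

variable {T : OpTree}

theorem s_mem (S : T.Subtree) {m : T.M} (h : T.p m ∈ S.nodes) :
    T.s m ∈ S.edges ∧ T.s m ≠ S.root := by
  have : T.s m ∈ S.edges \ {S.root} := S.image_s ▸ ⟨m, h, rfl⟩
  exact this

theorem exists_input (S : T.Subtree) {a : T.A} (h : a ∈ S.edges) (h' : a ≠ S.root) :
    ∃ m, T.p m ∈ S.nodes ∧ T.s m = a := by
  have : a ∈ T.s '' (T.p ⁻¹' S.nodes) := S.image_s ▸ ⟨h, h'⟩
  exact this

instance : Finite T.Subtree :=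
  Finite.of_injective (fun S : T.Subtree => (S.edges, S.nodes, S.root)) fun S S' h => by
    simp only [Prod.mk.injEq] at h
    exact Subtree.ext h.1 h.2.1 h.2.2

/-- A subtree, regarded as a tree. -/
def toTree (S : T.Subtree) : OpTree where
  A := S.edges
  M := T.p ⁻¹' S.nodes
  N := S.nodes
  s m := ⟨T.s m.1, (S.s_mem m.2).1⟩
  p m := ⟨T.p m.1, m.2⟩
  t n := ⟨T.t n.1, S.t_mem n.1 n.2⟩
  t_injective n n' h := Subtype.ext (T.t_injective (congrArg Subtype.val h))
  s_injective m m' h := Subtype.ext (T.s_injective (congrArg Subtype.val h))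
  root := ⟨S.root, S.root_mem⟩
  compl_range_s := by
    ext ⟨a, ha⟩
    simp only [Set.mem_compl_iff, Set.mem_range, Set.mem_singleton_iff, Subtype.mk.injEq]
    constructor
    · intro h
      by_contra hr
      obtain ⟨m, hm, rfl⟩ := S.exists_input ha hr
      exact h ⟨⟨m, hm⟩, rfl⟩
    · rintro rfl ⟨m, hm⟩
      exact (S.s_mem m.2).2 hm
  walk := by
    rintro ⟨a, ha⟩
    have h := T.walk a
    induction h using Relation.ReflTransGen.head_induction_on with
    | refl =>
      by_cases hr : T.root = S.root
      · exact (Subtype.ext hr : (⟨T.root, ha⟩ : S.edges) = ⟨S.root, S.root_mem⟩) ▸ .refl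
      · obtain ⟨m, -, hm⟩ := S.exists_input ha hr
        exact absurd hm (T.s_ne_root m)
    | @head a c hac _ ih =>
      by_cases hr : a = S.root
      · exact (Subtype.ext hr : (⟨a, ha⟩ : S.edges) = ⟨S.root, S.root_mem⟩) ▸ .refl
      · obtain ⟨m, hm, hma⟩ := S.exists_input ha hr
        obtain ⟨m', hm', rfl⟩ := hac
        obtain rfl := T.s_injective (hma.trans hm'.symm)
        exact .head ⟨⟨m, hm⟩, Subtype.ext hma, rfl⟩ (ih (S.t_mem _ hm))

/-- The leaves of a subtree: its edges that are not the output edge of a node of the subtree. -/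
def leaves (S : T.Subtree) : Set T.A := {a | a ∈ S.edges ∧ ∀ n ∈ S.nodes, T.t n ≠ a}

end Subtree

/-- The ideal subtree generated by the edge `e`, consisting of `e` (the new root) and all
edges and nodes above it. -/
def ideal (T : OpTree) (e : T.A) : T.Subtree where
  edges := {a | Relation.ReflTransGen T.Step a e}
  nodes := {n | Relation.ReflTransGen T.Step (T.t n) e}
  root := e
  root_mem := .refl
  t_mem _ h := h
  image_s := by
    ext a
    constructor
    · rintro ⟨m, hm, rfl⟩
      have hm : Relation.ReflTransGen T.Step (T.t (T.p m)) e := hm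
      refine ⟨.head ⟨m, rfl, rfl⟩ hm, ?_⟩
      rintro rfl
      exact T.not_transGen_self _ (.head' ⟨m, rfl, rfl⟩ hm)
    · rintro ⟨ha, hne⟩
      rcases Relation.ReflTransGen.cases_head ha with h | ⟨c, ⟨m, hm, rfl⟩, hc⟩
      · exact absurd h hne
      · exact ⟨m, hc, hm⟩

/-- A cut of a tree: a subtree containing the root. -/
abbrev Cut (T : OpTree) : Type := {S : T.Subtree // S.root = T.root}

/-- An isomorphism of trees. -/
structure Iso (T T' : OpTree) where
  onA : T.A ≃ T'.A
  onM : T.M ≃ T'.M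
  onN : T.N ≃ T'.N
  comm_s : ∀ m, onA (T.s m) = T'.s (onM m)
  comm_p : ∀ m, onN (T.p m) = T'.p (onM m)
  comm_t : ∀ n, onA (T.t n) = T'.t (onN n)

namespace Iso

variable {T T' : OpTree}

/-- The inverse isomorphism of trees. -/
def symm (f : Iso T T') : Iso T' T where
  onA := f.onA.symm
  onM := f.onM.symm
  onN := f.onN.symm
  comm_s m := by rw [Equiv.symm_apply_eq, f.comm_s, Equiv.apply_symm_apply]
  comm_p m := by rw [Equiv.symm_apply_eq, f.comm_p, Equiv.apply_symm_apply]
  comm_t m := by rw [Equiv.symm_apply_eq, f.comm_t, Equiv.apply_symm_apply]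

theorem map_root (f : Iso T T') : f.onA T.root = T'.root := by
  by_contra h
  obtain ⟨m, hm⟩ := T'.exists_s_eq h
  have := f.comm_s (f.onM.symm m)
  rw [Equiv.apply_symm_apply, hm] at this
  exact T.s_ne_root _ (f.onA.injective this)

theorem map_step (f : Iso T T') {a c : T.A} (h : T.Step a c) : T'.Step (f.onA a) (f.onA c) := by
  obtain ⟨m, rfl, rfl⟩ := h
  exact ⟨f.onM m, (f.comm_s m).symm, by rw [f.comm_t, f.comm_p]⟩

theorem map_walk (f : Iso T T') {a c : T.A} (h : Relation.ReflTransGen T.Step a c) :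
    Relation.ReflTransGen T'.Step (f.onA a) (f.onA c) :=
  Relation.ReflTransGen.lift f.onA (fun _ _ h => f.map_step h) _ _ h

theorem map_walk_iff (f : Iso T T') {a c : T.A} :
    Relation.ReflTransGen T'.Step (f.onA a) (f.onA c) ↔ Relation.ReflTransGen T.Step a c :=
  ⟨fun h => by simpa [symm] using f.symm.map_walk h, f.map_walk⟩

/-- The image of a subtree under an isomorphism of trees. -/
def mapSubtree (f : Iso T T') (S : T.Subtree) : T'.Subtree where
  edges := f.onA.symm ⁻¹' S.edges
  nodes := f.onN.symm ⁻¹' S.nodes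
  root := f.onA S.root
  root_mem := by simpa using S.root_mem
  t_mem n hn := by
    have := S.t_mem _ hn
    rwa [← show f.onA.symm (T'.t n) = T.t (f.onN.symm n) from f.symm.comm_t n] at this
  image_s := by
    ext a
    constructor
    · rintro ⟨m, hm, rfl⟩
      have hm : f.onN.symm (T'.p m) ∈ S.nodes := hm
      rw [show f.onN.symm (T'.p m) = T.p (f.onM.symm m) from f.symm.comm_p m] at hm
      have := S.s_mem hm
      rw [← show f.onA.symm (T'.s m) = T.s (f.onM.symm m) from f.symm.comm_s m] at this
      exact ⟨this.1, fun h => this.2 ((Equiv.symm_apply_eq _).2 h)⟩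
    · rintro ⟨ha, hne⟩
      obtain ⟨m, hm, hma⟩ := S.exists_input ha fun h => hne ((Equiv.symm_apply_eq _).1 h)
      refine ⟨f.onM m, ?_, ?_⟩
      · change f.onN.symm (T'.p (f.onM m)) ∈ S.nodes
        rwa [← f.comm_p, Equiv.symm_apply_apply]
      · rw [← f.comm_s, hma, Equiv.apply_symm_apply]

theorem mapSubtree_ideal (f : Iso T T') (e : T.A) :
    f.mapSubtree (T.ideal e) = T'.ideal (f.onA e) := by
  ext x
  · change Relation.ReflTransGen T.Step (f.onA.symm x) e ↔ Relation.ReflTransGen T'.Step x (f.onA e)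
    rw [← f.map_walk_iff, Equiv.apply_symm_apply]
  · change Relation.ReflTransGen T.Step (T.t (f.onN.symm x)) e ↔
      Relation.ReflTransGen T'.Step (T'.t x) (f.onA e)
    rw [← f.map_walk_iff, f.comm_t, Equiv.apply_symm_apply]
  · rfl

/-- The bijection on cuts induced by an isomorphism of trees. -/
def cutEquiv (f : Iso T T') : T.Cut ≃ T'.Cut where
  toFun c := ⟨f.mapSubtree c.1, by
    change f.onA c.1.root = _
    rw [c.2, f.map_root]⟩
  invFun c := ⟨f.symm.mapSubtree c.1, by
    change f.symm.onA c.1.root = _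
    rw [c.2, f.symm.map_root]⟩
  left_inv c := by
    refine Subtype.ext (Subtree.ext ?_ ?_ ?_)
    · ext x; simp [mapSubtree, symm]
    · ext x; simp [mapSubtree, symm]
    · simp [mapSubtree, symm]
  right_inv c := by
    refine Subtype.ext (Subtree.ext ?_ ?_ ?_)
    · ext x; simp [mapSubtree, symm]
    · ext x; simp [mapSubtree, symm]
    · simp [mapSubtree, symm]

/-- The bijection on leaves of subtrees induced by an isomorphism of trees. -/
def leavesEquiv (f : Iso T T') (S : T.Subtree) : S.leaves ≃ (f.mapSubtree S).leaves :=
  f.onA.subtypeEquiv fun a => by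
    change (a ∈ S.edges ∧ ∀ n ∈ S.nodes, T.t n ≠ a) ↔
      (f.onA.symm (f.onA a) ∈ S.edges ∧ ∀ n, f.onN.symm n ∈ S.nodes → T'.t n ≠ f.onA a)
    rw [Equiv.symm_apply_apply]
    refine and_congr_right fun _ => ⟨fun h n hn hna => h _ hn ?_, fun h n hn hna => ?_⟩
    · apply f.onA.injective
      rw [f.comm_t, Equiv.apply_symm_apply, hna]
    · refine h (f.onN n) (by simpa using hn) ?_
      rw [← f.comm_t, hna]

end Iso

end OpTree

/-! ### `P`-trees -/

/-- A `P`-tree: a diagram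
```
A ← M → N → A
↓   ↓   ↓   ↓
I ← E → B → I
```
commuting up to specified isomorphisms, whose top row is a tree and whose middle square is a
homotopy pullback.  As `M` and `N` are sets and the homotopy fibres of `p` are discrete, the latter
means that for each node `n`, decorated by `b`, the induced map from the
set of input edges of `n` to the arity of `b` is bijective; the condition `bij` expresses this for
all nodes together. -/
structure PTree (P : PolyEndo.{v, u}) where
  tree : OpTree
  edgeDec : tree.A → P.I
  inputDec : tree.M → P.E
  nodeDec : tree.N → P.B
  isoS : ∀ m, edgeDec (tree.s m) ⟶ P.s.obj (inputDec m)
  isoP : ∀ m, P.p.obj (inputDec m) ⟶ nodeDec (tree.p m)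
  isoT : ∀ n, edgeDec (tree.t n) ⟶ P.t.obj (nodeDec n)
  bij : Function.Bijective fun m : tree.M =>
    (⟨tree.p m, Quotient.mk _ (CostructuredArrow.mk (isoP m))⟩ : Σ n, P.Arity (nodeDec n))

namespace PTree

variable {P : PolyEndo.{v, u}}

/-- The decoration of the root edge. -/
def rootColour (X : PTree P) : P.I := X.edgeDec X.tree.root

/-- The `P`-tree structure on a subtree of the underlying tree of a `P`-tree. -/
def restrict (X : PTree P) (S : X.tree.Subtree) : PTree P where
  tree := S.toTree
  edgeDec a := X.edgeDec a.1
  inputDec m := X.inputDec m.1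
  nodeDec n := X.nodeDec n.1
  isoS m := X.isoS m.1
  isoP m := X.isoP m.1
  isoT n := X.isoT n.1
  bij := by
    constructor
    · intro m m' h
      exact Subtype.ext (X.bij.1 (congrArg (fun z : Σ n : S.nodes, P.Arity (X.nodeDec n.1) =>
        (⟨z.1.1, z.2⟩ : Σ n, P.Arity (X.nodeDec n))) h))
    · rintro ⟨⟨n, hn⟩, x⟩
      obtain ⟨m, hm⟩ := X.bij.2 ⟨n, x⟩
      cases hm
      exact ⟨⟨m, hn⟩, rfl⟩

/-- An isomorphism of `P`-trees: an isomorphism of the underlying trees, together with isomorphisms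
between the decorations of corresponding edges, inputs and nodes, compatible with the structure
isomorphisms of the two `P`-trees.  (For instance `decA` gives for each edge `a` an arrow from the
decoration of `a` to the decoration of its image `a'`.) -/
structure Iso (X Y : PTree P) where
  base : OpTree.Iso X.tree Y.tree
  decA : ∀ {a a'}, base.onA a = a' → (X.edgeDec a ⟶ Y.edgeDec a')
  decM : ∀ {m m'}, base.onM m = m' → (X.inputDec m ⟶ Y.inputDec m')
  decN : ∀ {n n'}, base.onN n = n' → (X.nodeDec n ⟶ Y.nodeDec n')
  comm_s : ∀ {m m'} (h : base.onM m = m') (h' : base.onA (X.tree.s m) = Y.tree.s m'),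
    decA h' ≫ Y.isoS m' = X.isoS m ≫ P.s.map (decM h)
  comm_p : ∀ {m m'} (h : base.onM m = m') (h' : base.onN (X.tree.p m) = Y.tree.p m'),
    P.p.map (decM h) ≫ Y.isoP m' = X.isoP m ≫ decN h'
  comm_t : ∀ {n n'} (h : base.onN n = n') (h' : base.onA (X.tree.t n) = Y.tree.t n'),
    decA h' ≫ Y.isoT n' = X.isoT n ≫ P.t.map (decN h)

namespace Iso

/-- The identity isomorphism. -/
def refl (X : PTree P) : Iso X X where
  base := ⟨.refl _, .refl _, .refl _, fun _ => rfl, fun _ => rfl, fun _ => rfl⟩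
  decA h := eqToHom (congrArg X.edgeDec h)
  decM h := eqToHom (congrArg X.inputDec h)
  decN h := eqToHom (congrArg X.nodeDec h)
  comm_s h _ := by
    cases h
    exact (Category.id_comp _).trans
      ((Category.comp_id _).symm.trans (congrArg (_ ≫ ·) (P.s.map_id _).symm))
  comm_p h _ := by
    cases h
    exact (congrArg (· ≫ _) (P.p.map_id _)).trans
      ((Category.id_comp _).trans (Category.comp_id _).symm)
  comm_t h _ := by
    cases h
    exact (Category.id_comp _).trans
      ((Category.comp_id _).symm.trans (congrArg (_ ≫ ·) (P.t.map_id _).symm))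

/-- The inverse isomorphism. -/
def symm {X Y : PTree P} (f : Iso X Y) : Iso Y X where
  base := f.base.symm
  decA h := Groupoid.inv (f.decA ((Equiv.symm_apply_eq _).1 h).symm)
  decM h := Groupoid.inv (f.decM ((Equiv.symm_apply_eq _).1 h).symm)
  decN h := Groupoid.inv (f.decN ((Equiv.symm_apply_eq _).1 h).symm)
  comm_s {m m'} h h' := by
    have := f.comm_s ((Equiv.symm_apply_eq _).1 h).symm ((Equiv.symm_apply_eq _).1 h').symm
    simp only [Groupoid.inv_eq_inv, Functor.map_inv]
    rw [IsIso.inv_comp_eq, ← Category.assoc, IsIso.eq_comp_inv]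
    exact this.symm
  comm_p {m m'} h h' := by
    have := f.comm_p ((Equiv.symm_apply_eq _).1 h).symm ((Equiv.symm_apply_eq _).1 h').symm
    simp only [Groupoid.inv_eq_inv, Functor.map_inv]
    rw [IsIso.inv_comp_eq, ← Category.assoc, IsIso.eq_comp_inv]
    exact this.symm
  comm_t {m m'} h h' := by
    have := f.comm_t ((Equiv.symm_apply_eq _).1 h).symm ((Equiv.symm_apply_eq _).1 h').symm
    simp only [Groupoid.inv_eq_inv, Functor.map_inv]
    rw [IsIso.inv_comp_eq, ← Category.assoc, IsIso.eq_comp_inv]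
    exact this.symm

/-- The composite of two isomorphisms. -/
def trans {X Y Z : PTree P} (f : Iso X Y) (g : Iso Y Z) : Iso X Z where
  base :=
    { onA := f.base.onA.trans g.base.onA
      onM := f.base.onM.trans g.base.onM
      onN := f.base.onN.trans g.base.onN
      comm_s := fun m => by simp [f.base.comm_s, g.base.comm_s]
      comm_p := fun m => by simp [f.base.comm_p, g.base.comm_p]
      comm_t := fun m => by simp [f.base.comm_t, g.base.comm_t] }
  decA h := f.decA rfl ≫ g.decA h
  decM h := f.decM rfl ≫ g.decM h
  decN h := f.decN rfl ≫ g.decN h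
  comm_s {m m'} h h' := by
    have key : ∀ {y} (e : f.base.onA (X.tree.s m) = y) (e' : g.base.onA y = Z.tree.s m'),
        f.decA rfl ≫ g.decA h' = f.decA e ≫ g.decA e' := by rintro _ rfl _; rfl
    rw [key (f.base.comm_s m) (by rw [← f.base.comm_s]; exact h'), Category.assoc,
      g.comm_s h, ← Category.assoc, f.comm_s rfl, Category.assoc, Functor.map_comp]
  comm_p {m m'} h h' := by
    have key : ∀ {y} (e : f.base.onN (X.tree.p m) = y) (e' : g.base.onN y = Z.tree.p m'),
        f.decN rfl ≫ g.decN h' = f.decN e ≫ g.decN e' := by rintro _ rfl _; rfl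
    have e' : g.base.onN (Y.tree.p (f.base.onM m)) = Z.tree.p m' := by
      rw [← f.base.comm_p]; exact h'
    rw [key (f.base.comm_p m) e', Functor.map_comp, Category.assoc,
      g.comm_p h e', ← Category.assoc, f.comm_p rfl (f.base.comm_p m), Category.assoc]
  comm_t {m m'} h h' := by
    have key : ∀ {y} (e : f.base.onA (X.tree.t m) = y) (e' : g.base.onA y = Z.tree.t m'),
        f.decA rfl ≫ g.decA h' = f.decA e ≫ g.decA e' := by rintro _ rfl _; rfl
    rw [key (f.base.comm_t m) (by rw [← f.base.comm_t]; exact h'), Category.assoc,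
      g.comm_t h, ← Category.assoc, f.comm_t rfl, Category.assoc, Functor.map_comp]

/-- Restriction of an isomorphism of `P`-trees to a subtree and its image. -/
def restrict {X Y : PTree P} (f : Iso X Y) (S : X.tree.Subtree) :
    Iso (X.restrict S) (Y.restrict (f.base.mapSubtree S)) where
  base :=
    { onA := f.base.onA.subtypeEquiv fun a => by
        change _ ↔ f.base.onA.symm (f.base.onA a) ∈ S.edges
        rw [Equiv.symm_apply_apply]
      onM := f.base.onM.subtypeEquiv fun m => by
        change X.tree.p m ∈ S.nodes ↔ f.base.onN.symm (Y.tree.p (f.base.onM m)) ∈ S.nodes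
        rw [← f.base.comm_p, Equiv.symm_apply_apply]
      onN := f.base.onN.subtypeEquiv fun n => by
        change _ ↔ f.base.onN.symm (f.base.onN n) ∈ S.nodes
        rw [Equiv.symm_apply_apply]
      comm_s := fun m => Subtype.ext (f.base.comm_s m.1)
      comm_p := fun m => Subtype.ext (f.base.comm_p m.1)
      comm_t := fun n => Subtype.ext (f.base.comm_t n.1) }
  decA h := f.decA (congrArg Subtype.val h)
  decM h := f.decM (congrArg Subtype.val h)
  decN h := f.decN (congrArg Subtype.val h)
  comm_s h h' := f.comm_s (congrArg Subtype.val h) (congrArg Subtype.val h')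
  comm_p h h' := f.comm_p (congrArg Subtype.val h) (congrArg Subtype.val h')
  comm_t h h' := f.comm_t (congrArg Subtype.val h) (congrArg Subtype.val h')

end Iso

/-- Two `P`-trees are equivalent if they are isomorphic. -/
instance setoid (P : PolyEndo.{v, u}) : Setoid (PTree P) where
  r X Y := Nonempty (Iso X Y)
  iseqv := ⟨fun X => ⟨.refl X⟩, fun ⟨f⟩ => ⟨f.symm⟩, fun ⟨f⟩ ⟨g⟩ => ⟨f.trans g⟩⟩

end PTree

/-- The set of isomorphism classes of `P`-trees. -/
abbrev TreeClass (P : PolyEndo.{v, u}) := Quotient (PTree.setoid P)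

/-! ### The bialgebra of `P`-trees -/

/-- The free commutative `ℚ`-algebra on the set of isomorphism classes of `P`-trees. -/
def TreeAlg (P : PolyEndo.{v, u}) := MvPolynomial (TreeClass P) ℚ

noncomputable instance (P : PolyEndo.{v, u}) : CommRing (TreeAlg P) :=
  inferInstanceAs (CommRing (MvPolynomial (TreeClass P) ℚ))

noncomputable instance (P : PolyEndo.{v, u}) : Algebra ℚ (TreeAlg P) :=
  inferInstanceAs (Algebra ℚ (MvPolynomial (TreeClass P) ℚ))

namespace PTree

variable {P : PolyEndo.{v, u}}

/-- The generator given by the isomorphism class of a `P`-tree. -/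
noncomputable def gen (X : PTree P) : TreeAlg P := MvPolynomial.X (Quotient.mk _ X)

theorem gen_eq_of_iso {X Y : PTree P} (f : Iso X Y) : X.gen = Y.gen :=
  congrArg (MvPolynomial.X (R := ℚ)) (Quotient.sound ⟨f⟩)

/-- The sum over all cuts `S` of a `P`-tree of `P_S ⊗ S`, where `P_S` is the forest of
the ideal subtrees generated by the leaves of `S`. -/
noncomputable def cutSum (X : PTree P) : TreeAlg P ⊗[ℚ] TreeAlg P :=
  letI := Fintype.ofFinite X.tree.Cut
  letI := fun c : X.tree.Cut => Fintype.ofFinite c.1.leaves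
  ∑ c : X.tree.Cut,
    (∏ e : c.1.leaves, (X.restrict (X.tree.ideal e.1)).gen) ⊗ₜ[ℚ] (X.restrict c.1).gen

theorem cutSum_eq_of_iso {X Y : PTree P} (f : Iso X Y) : X.cutSum = Y.cutSum := by
  unfold cutSum
  let := Fintype.ofFinite X.tree.Cut
  let := Fintype.ofFinite Y.tree.Cut
  refine Fintype.sum_equiv f.base.cutEquiv _ _ fun c => ?_
  let := Fintype.ofFinite c.1.leaves
  let : Fintype (f.base.mapSubtree c.1).leaves := Fintype.ofFinite _
  congr 1
  · refine Fintype.prod_equiv (f.base.leavesEquiv c.1) _ _ fun e => ?_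
    rw [gen_eq_of_iso (f.restrict _), OpTree.Iso.mapSubtree_ideal]
    rfl
  · exact gen_eq_of_iso (f.restrict c.1)

open Classical in
/-- The counit on a `P`-tree: `1` if the tree has no nodes, and `0` otherwise. -/
noncomputable def counitValue (X : PTree P) : ℚ := if IsEmpty X.tree.N then 1 else 0

theorem counitValue_eq_of_iso {X Y : PTree P} (f : Iso X Y) : X.counitValue = Y.counitValue := by
  unfold counitValue
  rw [f.base.onN.isEmpty_congr]

end PTree

namespace TreeAlg

variable (P : PolyEndo.{v, u})

/-- The comultiplication: the algebra homomorphism sending each `P`-tree to the sum over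
its cuts. -/
noncomputable def comulHom : TreeAlg P →ₐ[ℚ] TreeAlg P ⊗[ℚ] TreeAlg P :=
  MvPolynomial.aeval (Quotient.lift PTree.cutSum fun _ _ ⟨f⟩ => PTree.cutSum_eq_of_iso f)

/-- The counit: the algebra homomorphism sending each nodeless `P`-tree to `1` and all other
`P`-trees to `0`. -/
noncomputable def counitHom : TreeAlg P →ₐ[ℚ] ℚ :=
  MvPolynomial.aeval (Quotient.lift PTree.counitValue fun _ _ ⟨f⟩ => PTree.counitValue_eq_of_iso f)

noncomputable instance coalgebraStruct : CoalgebraStruct ℚ (TreeAlg P) where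
  comul := (comulHom P).toLinearMap
  counit := (counitHom P).toLinearMap

/-- The algebra of `P`-trees, with the comultiplication and counit above, is a bialgebra: the
comultiplication is coassociative and counital.  (Both maps are algebra homomorphisms by
construction.) -/
def IsBialgebra : Prop :=
  ∃ c : Coalgebra ℚ (TreeAlg P), c.toCoalgebraStruct = coalgebraStruct P

end TreeAlg

/-! ### Forests, grafting and the `B_+`-operators -/

/-- A `P`-forest: a finite family (disjoint union) of `P`-trees. -/
structure PForest (P : PolyEndo.{v, u}) where
  ι : Type
  [fin : Finite ι]
  tree : ι → PTree P

attribute [instance] PForest.fin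

/-- A matching of the roots of the forest `F` with the leaves of the corolla `b`: a bijection
between the set of roots and the arity of `b`, together with an isomorphism between the colour
of each root and the colour of the corresponding leaf.  A forest with such a matching is an object
of the homotopy fibre product of the groupoid of forests with `{b}` over the groupoid of
nodeless forests; it amounts to an `E_b`-indexed family of `P`-trees. -/
structure PForest.Matching {P : PolyEndo.{v, u}} (F : PForest P) (b : P.B) where
  equiv : F.ι ≃ P.Arity b
  iso : ∀ k, (F.tree k).rootColour ⟶ P.inColour (equiv k)

namespace PForest

variable {P : PolyEndo.{v, u}}

/-- The underlying tree of a grafting: the trees of the forest, grafted onto a new node `none`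
with output edge `none`. -/
def graftTree (F : PForest P) : OpTree where
  A := Option (Σ k, (F.tree k).tree.A)
  M := F.ι ⊕ (Σ k, (F.tree k).tree.M)
  N := Option (Σ k, (F.tree k).tree.N)
  s := Sum.elim (fun k => some ⟨k, (F.tree k).tree.root⟩)
    (fun m => some ⟨m.1, (F.tree m.1).tree.s m.2⟩)
  p := Sum.elim (fun _ => none) (fun m => some ⟨m.1, (F.tree m.1).tree.p m.2⟩)
  t := Option.map fun n => ⟨n.1, (F.tree n.1).tree.t n.2⟩
  t_injective := Option.map_injective fun ⟨k, n⟩ ⟨k', n'⟩ h => by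
    simp only [Sigma.mk.injEq] at h
    obtain ⟨rfl, h⟩ := h
    rw [(F.tree k).tree.t_injective (eq_of_heq h)]
  s_injective := by
    rintro (k | ⟨k, m⟩) (k' | ⟨k', m'⟩) h <;>
      simp only [Sum.elim_inl, Sum.elim_inr, Option.some.injEq, Sigma.mk.injEq] at h <;>
      obtain ⟨rfl, h⟩ := h
    · rfl
    · exact absurd (eq_of_heq h).symm ((F.tree k).tree.s_ne_root m')
    · exact absurd (eq_of_heq h) ((F.tree k).tree.s_ne_root m)
    · rw [(F.tree k).tree.s_injective (eq_of_heq h)]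
  root := none
  compl_range_s := by
    ext a
    simp only [Set.mem_compl_iff, Set.mem_range, Set.mem_singleton_iff]
    constructor
    · intro h
      rcases a with _ | ⟨k, a⟩
      · rfl
      · exfalso
        by_cases ha : a = (F.tree k).tree.root
        · exact h ⟨.inl k, by simp [ha]⟩
        · obtain ⟨m, hm⟩ := (F.tree k).tree.exists_s_eq ha
          exact h ⟨.inr ⟨k, m⟩, by simp [hm]⟩
    · rintro rfl ⟨k | m, h⟩ <;> simp at h
  walk := by
    rintro (_ | ⟨k, a⟩)
    · exact .refl
    · refine .tail (b := some ⟨k, (F.tree k).tree.root⟩) ?_ ⟨.inl k, rfl, rfl⟩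
      refine Relation.ReflTransGen.lift
        (fun a => (some ⟨k, a⟩ : Option (Σ k, (F.tree k).tree.A))) ?_ _ _ ((F.tree k).tree.walk a)
      rintro a c ⟨m, rfl, rfl⟩
      exact ⟨.inr ⟨k, m⟩, rfl, rfl⟩

/-- The `P`-tree obtained by grafting the trees of a forest onto the corolla `b`, along a matching
of the roots of the forest with the leaves of the corolla. -/
noncomputable def graft (F : PForest P) {b : P.B} (θ : F.Matching b) : PTree P where
  tree := F.graftTree
  edgeDec
    | none => P.t.obj b
    | some a => (F.tree a.1).edgeDec a.2
  inputDec
    | .inl k => (θ.equiv k).out.left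
    | .inr m => (F.tree m.1).inputDec m.2
  nodeDec
    | none => b
    | some n => (F.tree n.1).nodeDec n.2
  isoS
    | .inl k => θ.iso k
    | .inr m => (F.tree m.1).isoS m.2
  isoP
    | .inl k => (θ.equiv k).out.hom
    | .inr m => (F.tree m.1).isoP m.2
  isoT
    | none => 𝟙 _
    | some n => (F.tree n.1).isoT n.2
  bij := by
    have out_eq (y : P.Arity b) : (Quotient.mk _ (CostructuredArrow.mk y.out.hom) : P.Arity b) = y :=
      Quotient.out_eq y
    constructor
    · rintro (k | ⟨k, m⟩) (k' | ⟨k', m'⟩) h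
      · have h := (out_eq _).symm.trans ((eq_of_heq (Sigma.mk.inj h).2).trans (out_eq _))
        rw [θ.equiv.injective h]
      · exact absurd (Sigma.mk.inj h).1 (Option.some_ne_none _).symm
      · exact absurd (Sigma.mk.inj h).1 (Option.some_ne_none _)
      · have h := Option.some.inj (congrArg (fun z => match z with
          | ⟨none, _⟩ => none
          | ⟨some n, x⟩ =>
            some (⟨n.1, n.2, x⟩ : Σ k, Σ n, P.Arity ((F.tree k).nodeDec n))) h)
        have hk : k = k' := (Sigma.mk.inj h).1
        subst hk
        have hm : m = m' := (F.tree k).bij.1 (eq_of_heq (Sigma.mk.inj h).2)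
        rw [hm]
    · rintro ⟨_ | ⟨k, n⟩, x⟩
      · refine ⟨.inl (θ.equiv.symm x), congrArg (Sigma.mk none) ?_⟩
        exact (out_eq _).trans (θ.equiv.apply_symm_apply x)
      · obtain ⟨m, hm⟩ := (F.tree k).bij.2 ⟨n, x⟩
        cases hm
        exact ⟨.inr ⟨k, m⟩, rfl⟩

/-- The sum, over all matchings of the roots of the forest `F` with the leaves of
the corolla `b`, of the graftings of `F` onto `b`.  (If the groupoid of colours has finite hom-sets,
there are only finitely many matchings.) -/
noncomputable def graftSum (F : PForest P) (b : P.B) : TreeAlg P :=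
  ∑ᶠ θ : F.Matching b, (F.graft θ).gen

/-- A forest representing a monomial in `P`-trees. -/
noncomputable def ofMonomial (m : TreeClass P →₀ ℕ) : PForest P where
  ι := Fin (Finsupp.toMultiset m).toList.length
  tree k := ((Finsupp.toMultiset m).toList.get k).out

end PForest

/-- The `B_+`-operator corresponding to the operation `b`: the linear map that sends each forest
(each monomial in `P`-trees) to the sum of its graftings onto the corolla `b`, over all matchings of
its roots with the leaves of `b`.  This is the linear map given by the span
`F₁ ← F₁ ×_{F₀} {b} → T`, whose fibre over a forest is the set of these matchings. -/
noncomputable def bPlus {P : PolyEndo.{v, u}} (b : P.B) : TreeAlg P →ₗ[ℚ] TreeAlg P :=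
  (MvPolynomial.basisMonomials (TreeClass P) ℚ).constr ℚ
    fun m => (PForest.ofMonomial m).graftSum b

/-! ### Redecoration along a cartesian morphism -/

namespace CartMor

variable {P' : PolyEndo.{v', u'}} {P : PolyEndo.{v, u}} (u : CartMor P' P)

/-- The map on objects of homotopy fibres induced by a cartesian morphism. -/
def fibreObj {b : P'.B} (x : CostructuredArrow P'.p b) :
    CostructuredArrow P.p (u.onB.obj b) :=
  CostructuredArrow.mk (Y := u.onE.obj x.left) (u.sqP.hom.app x.left ≫ u.onB.map x.hom)

theorem nonempty_fibreMap {b : P'.B} {x y : CostructuredArrow P'.p b} (f : x ⟶ y) :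
    Nonempty (u.fibreObj x ⟶ u.fibreObj y) := by
  refine ⟨CostructuredArrow.homMk (u.onE.map f.left) ?_⟩
  have h := u.sqP.hom.naturality f.left
  have w := CostructuredArrow.w f
  simp only [Functor.comp_map] at h
  change P.p.map (u.onE.map f.left) ≫ u.sqP.hom.app y.left ≫ u.onB.map y.hom =
    u.sqP.hom.app x.left ≫ u.onB.map x.hom
  rw [← Category.assoc, h, Category.assoc, ← Functor.map_comp, w]

/-- The map on arities induced by a cartesian morphism. -/
def onArity (b : P'.B) : P'.Arity b → P.Arity (u.onB.obj b) :=
  Quotient.lift (fun x => Quotient.mk _ (u.fibreObj x)) fun _ _ ⟨f⟩ =>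
    P.mk_eq_of_hom (u.nonempty_fibreMap f.hom).some

theorem onArity_bijective (b : P'.B) : Function.Bijective (u.onArity b) := by
  have := u.isPullback
  constructor
  · intro x y h
    induction x using Quotient.inductionOn with | _ x
    induction y using Quotient.inductionOn with | _ y
    obtain ⟨f⟩ := P.nonempty_hom_of_mk_eq h
    have hf : P.p.map f.left ≫ u.sqP.hom.app y.left ≫ u.onB.map y.hom =
      u.sqP.hom.app x.left ≫ u.onB.map x.hom := CostructuredArrow.w f
    have aux {a b c d : P.B} (f : a ⟶ b) (g : b ⟶ c) (h : c ⟶ d) (h' : d ⟶ c)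
        (e : h ≫ h' = 𝟙 c) : f ≫ g = (f ≫ g ≫ h) ≫ h' := by simp [e]
    let g : (pullbackComparison u.sqP).obj x.left ⟶ (pullbackComparison u.sqP).obj y.left :=
      { fst := f.left
        snd := x.hom ≫ Groupoid.inv y.hom
        w := by
          change P.p.map f.left ≫ u.sqP.hom.app y.left =
            u.sqP.hom.app x.left ≫ u.onB.map (x.hom ≫ Groupoid.inv y.hom)
          rw [Functor.map_comp, ← Category.assoc, ← hf]
          refine aux _ _ _ _ ?_
          rw [← Functor.map_comp, Groupoid.comp_inv]
          exact u.onB.map_id _ }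
    refine P'.mk_eq_of_hom
      (CostructuredArrow.homMk ((pullbackComparison u.sqP).preimage g) ?_)
    have hg := congrArg Limits.CategoricalPullback.Hom.snd
      ((pullbackComparison u.sqP).map_preimage g)
    have hg : P'.p.map ((pullbackComparison u.sqP).preimage g) = x.hom ≫ Groupoid.inv y.hom := hg
    rw [hg]
    simp
  · intro y
    induction y using Quotient.inductionOn with | _ y
    let z : Limits.CategoricalPullback P.p u.onB :=
      ⟨y.left, b, (Groupoid.isoEquivHom _ _).symm y.hom⟩
    let e := (pullbackComparison u.sqP).objObjPreimageIso z
    let w := (pullbackComparison u.sqP).objPreimage z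
    have hw : P.p.map e.hom.fst ≫ y.hom = u.sqP.hom.app w ≫ u.onB.map e.hom.snd := e.hom.w
    refine ⟨Quotient.mk _ (CostructuredArrow.mk (Y := w) e.hom.snd), ?_⟩
    exact P.mk_eq_of_hom (CostructuredArrow.homMk e.hom.fst hw)

/-- The bijection on arities induced by a cartesian morphism. -/
noncomputable def arityEquiv (b : P'.B) : P'.Arity b ≃ P.Arity (u.onB.obj b) :=
  Equiv.ofBijective _ (u.onArity_bijective b)

/-- Redecoration: composition of the diagram of a `P'`-tree with the diagram of the cartesian
morphism. -/
def redecorate (X : PTree P') : PTree P where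
  tree := X.tree
  edgeDec a := u.onI.obj (X.edgeDec a)
  inputDec m := u.onE.obj (X.inputDec m)
  nodeDec n := u.onB.obj (X.nodeDec n)
  isoS m := u.onI.map (X.isoS m) ≫ u.sqS.hom.app (X.inputDec m)
  isoP m := u.sqP.hom.app (X.inputDec m) ≫ u.onB.map (X.isoP m)
  isoT n := u.onI.map (X.isoT n) ≫ u.sqT.hom.app (X.nodeDec n)
  bij := (Equiv.sigmaCongrRight fun n => u.arityEquiv (X.nodeDec n)).bijective.comp X.bij

/-- Redecoration of all trees of a forest. -/
def redecorateForest (F : PForest P') : PForest P where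
  ι := F.ι
  tree k := u.redecorate (F.tree k)

/-- The isomorphism, over the bijection of arities, between the image of a representative of
`x` and the representative of the image of `x`; it is unique, as homotopy fibres of `P.p`
are discrete. -/
noncomputable def outHom {b : P'.B} (x : P'.Arity b) :
    u.fibreObj x.out ⟶ (u.arityEquiv b x).out :=
  (P.nonempty_hom_of_mk_eq (by
    rw [Quotient.out_eq]
    conv_rhs => rw [← Quotient.out_eq x]
    rfl)).some

/-- Redecoration of a matching of the roots of a forest with the leaves of a corolla. -/
noncomputable def redecorateMatching {F : PForest P'} {b : P'.B} (θ : F.Matching b) :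
    (u.redecorateForest F).Matching (u.onB.obj b) where
  equiv := θ.equiv.trans (u.arityEquiv b)
  iso k := u.onI.map (θ.iso k) ≫ u.sqS.hom.app (θ.equiv k).out.left ≫
    P.s.map (u.outHom (θ.equiv k)).left

end CartMor

/-! ### Subtrees of subtrees -/

namespace OpTree

/-! Coassociativity is a count of nested pairs of cuts. Expanding either iterated coproduct of a
tree gives the sum over cuts `c ⊆ d` of `P_d ⊗ (the parts of d above the leaves of c) ⊗ c`. One side
chooses `d` first and then a cut `c` of `d` (`cutSum_restrict`). The other chooses `c` first and
then cuts every tree of the forest `P_c`; a product of sums over the leaves becomes a sum over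
choices of one subtree per leaf, and such choices are exactly the cuts finer than `c`
(`aboveLeaf_bijective`, `leaves_bijective`, `prod_cutSum_leaves`). This rests on the walk to the
root being deterministic and acyclic: a node outside `c` lies above exactly one leaf of `c`. For the
counit, only the total cut survives on the left and only the root cut on the right.

Redecoration does not touch the underlying tree, so it preserves cuts, leaves and restrictions,
hence also the coproduct and the counit. A cartesian morphism identifies arities, so grafting
commutes with redecoration up to an isomorphism assembled from `sqT` at the new root edge and from
the comparison of chosen fibre representatives, `outHom`, at the new inputs (`redecorateGraftIso`).
Full faithfulness on colours makes the colour isomorphisms of matchings correspond as well. The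
operator identity is then checked on monomials; it needs `graftSum_eq`, because the forest
representing a monomial involves choices that redecoration does not respect strictly. -/

theorem step_rightUnique (T : OpTree) : Relator.RightUnique T.Step := by
  rintro a c c' ⟨m, hm, rfl⟩ ⟨m', hm', rfl⟩
  rw [T.s_injective (hm.trans hm'.symm)]

namespace Subtree

variable {T : OpTree}

theorem edges_eq (S : T.Subtree) : S.edges = insert S.root (T.s '' (T.p ⁻¹' S.nodes)) := by
  rw [S.image_s, Set.insert_sdiff_singleton, Set.insert_eq_of_mem S.root_mem]

/-- The edges are the root together with the inputs of the nodes, so they carry no further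
information. Equalities of subtrees are therefore checked on nodes. -/
theorem ext_nodes {S S' : T.Subtree} (hr : S.root = S'.root) (hn : S.nodes = S'.nodes) :
    S = S' :=
  Subtree.ext (by rw [S.edges_eq, S'.edges_eq, hr, hn]) hn hr

theorem edges_subset {R S : T.Subtree} (hr : R.root ∈ S.edges) (hn : R.nodes ⊆ S.nodes) :
    R.edges ⊆ S.edges := by
  rw [R.edges_eq]
  rintro _ (rfl | ⟨m, hm, rfl⟩)
  · exact hr
  · exact (S.s_mem (hn hm)).1

theorem walk_of_toTree (S : T.Subtree) {a c : S.edges}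
    (h : Relation.ReflTransGen S.toTree.Step a c) : Relation.ReflTransGen T.Step a.1 c.1 := by
  refine Relation.ReflTransGen.lift Subtype.val ?_ _ _ h
  rintro _ _ ⟨m, rfl, rfl⟩
  exact ⟨m.1, rfl, rfl⟩

theorem walk_root (S : T.Subtree) {a : T.A} (h : a ∈ S.edges) :
    Relation.ReflTransGen T.Step a S.root :=
  S.walk_of_toTree (S.toTree.walk ⟨a, h⟩)

/-- Every edge of `S` walks down to the root of `S`; a nontrivial walk from that root back into `S`
would close a cycle. -/
theorem eq_root_of_walk (S : T.Subtree) {a : T.A} (h : a ∈ S.edges)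
    (h' : Relation.ReflTransGen T.Step S.root a) : a = S.root := by
  rcases (Relation.reflTransGen_iff_eq_or_transGen).1 h' with h' | h'
  · exact h'
  · exact absurd (h'.trans_left (S.walk_root h)) (T.not_transGen_self _)

theorem p_mem_of_step (S : T.Subtree) {m : T.M} (h : T.s m ∈ S.edges) (hr : T.s m ≠ S.root) :
    T.p m ∈ S.nodes := by
  obtain ⟨m', hm', h'⟩ := S.exists_input h hr
  rwa [← T.s_injective h']

/-- A walk between two edges of `S` cannot leave `S`: a step from a non-root edge passes through a
node of `S`, and at the root of `S` the walk must already have ended. -/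
theorem toTree_walk (S : T.Subtree) {a c : T.A} (ha : a ∈ S.edges) (hc : c ∈ S.edges)
    (h : Relation.ReflTransGen T.Step a c) :
    Relation.ReflTransGen S.toTree.Step (⟨a, ha⟩ : S.edges) (⟨c, hc⟩ : S.edges) := by
  induction h using Relation.ReflTransGen.head_induction_on with
  | refl => exact .refl
  | @head a d had hdc ih =>
    by_cases hr : a = S.root
    · obtain rfl : c = a := (S.eq_root_of_walk hc (hr ▸ .head had hdc)).trans hr.symm
      exact .refl
    · obtain ⟨m, rfl, rfl⟩ := had
      have hm := S.p_mem_of_step ha hr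
      exact .head ⟨⟨m, hm⟩, rfl, rfl⟩ (ih (S.t_mem _ hm))

/-- A subtree of a subtree, regarded as a subtree of the whole tree. -/
def lift (S : T.Subtree) (R : S.toTree.Subtree) : T.Subtree where
  edges := {a | ∃ h : a ∈ S.edges, (⟨a, h⟩ : S.edges) ∈ R.edges}
  nodes := {n | ∃ h : n ∈ S.nodes, (⟨n, h⟩ : S.nodes) ∈ R.nodes}
  root := (show S.edges from R.root).1
  root_mem := ⟨_, R.root_mem⟩
  t_mem := fun n ⟨h, hn⟩ => ⟨S.t_mem n h, R.t_mem _ hn⟩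
  image_s := by
    ext a
    constructor
    · rintro ⟨m, ⟨h, hm⟩, rfl⟩
      have := R.s_mem (m := (⟨m, h⟩ : T.p ⁻¹' S.nodes)) hm
      exact ⟨⟨(S.s_mem h).1, this.1⟩, fun h => this.2 (Subtype.ext h)⟩
    · rintro ⟨⟨h, ha⟩, hne⟩
      obtain ⟨m, hm, hma⟩ := R.exists_input ha fun h => hne (congrArg Subtype.val h)
      exact ⟨m.1, ⟨m.2, hm⟩, congrArg Subtype.val hma⟩

/-- A subtree contained in another subtree, regarded as a subtree of the latter. -/
def colift (S R : T.Subtree) (hr : R.root ∈ S.edges) (hn : R.nodes ⊆ S.nodes) :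
    S.toTree.Subtree where
  edges := {a | (show S.edges from a).1 ∈ R.edges}
  nodes := {n | (show S.nodes from n).1 ∈ R.nodes}
  root := (⟨R.root, hr⟩ : S.edges)
  root_mem := R.root_mem
  t_mem n hn := R.t_mem _ hn
  image_s := by
    ext ⟨a, ha⟩
    constructor
    · rintro ⟨m, hm, h⟩
      have h : T.s m.1 = a := congrArg Subtype.val h
      have := R.s_mem (m := m.1) hm
      rw [h] at this
      exact ⟨this.1, fun h => this.2 (congrArg Subtype.val h)⟩
    · rintro ⟨h, hne⟩
      obtain ⟨m, hm, hma⟩ := R.exists_input h fun h => hne (Subtype.ext h)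
      exact ⟨⟨m, hn hm⟩, hm, Subtype.ext hma⟩

theorem lift_nodes_subset (S : T.Subtree) (R : S.toTree.Subtree) :
    (S.lift R).nodes ⊆ S.nodes := fun _ h => h.1

theorem lift_colift (S R : T.Subtree) (hr : R.root ∈ S.edges) (hn : R.nodes ⊆ S.nodes) :
    S.lift (S.colift R hr hn) = R :=
  ext_nodes rfl (Set.ext fun _ => ⟨fun h => h.2, fun h => ⟨hn h, h⟩⟩)

theorem lift_injective (S : T.Subtree) : Function.Injective S.lift := by
  intro R R' h
  refine ext_nodes (Subtype.ext (congrArg Subtree.root h)) (Set.ext fun n => ?_)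
  have := Set.ext_iff.1 (congrArg Subtree.nodes h) n.1
  exact ⟨fun hn => (this.1 ⟨n.2, hn⟩).2, fun hn => (this.2 ⟨n.2, hn⟩).2⟩

/-- The leaves of a subtree of a subtree. -/
def liftLeavesEquiv (S : T.Subtree) (R : S.toTree.Subtree) : R.leaves ≃ (S.lift R).leaves where
  toFun a := ⟨(show S.edges from a.1).1, ⟨a.1.2, a.2.1⟩,
    fun n ⟨h, hn⟩ hna => a.2.2 ⟨n, h⟩ hn (Subtype.ext hna)⟩
  invFun a := ⟨(⟨a.1, a.2.1.1⟩ : S.edges), a.2.1.2,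
    fun n hn hna => a.2.2 n.1 ⟨n.2, hn⟩ (congrArg Subtype.val hna)⟩
  left_inv _ := rfl
  right_inv _ := rfl

/-- The part of a subtree that lies above one of its edges. -/
def above (S : T.Subtree) (e : S.edges) : T.Subtree := S.lift (S.toTree.ideal e)

theorem mem_above_nodes (S : T.Subtree) (e : S.edges) {n : T.N} :
    n ∈ (S.above e).nodes ↔ n ∈ S.nodes ∧ Relation.ReflTransGen T.Step (T.t n) e.1 :=
  ⟨fun ⟨h, hn⟩ => ⟨h, S.walk_of_toTree hn⟩,
    fun ⟨h, hn⟩ => ⟨h, S.toTree_walk (S.t_mem n h) e.2 hn⟩⟩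

theorem mem_above_edges (S : T.Subtree) (e : S.edges) {a : T.A} :
    a ∈ (S.above e).edges ↔ a ∈ S.edges ∧ Relation.ReflTransGen T.Step a e.1 :=
  ⟨fun ⟨h, hn⟩ => ⟨h, S.walk_of_toTree hn⟩, fun ⟨h, hn⟩ => ⟨h, S.toTree_walk h e.2 hn⟩⟩

/-- An ideal subtree omits nothing above its edges, so cutting it prunes the same trees as cutting
the whole tree. -/
theorem above_ideal (f : T.A) (e : (T.ideal f).edges) : (T.ideal f).above e = T.ideal e.1 :=
  ext_nodes rfl (Set.ext fun _ => ((T.ideal f).mem_above_nodes e).trans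
    ⟨fun h => h.2, fun h => ⟨h.trans e.2, h⟩⟩)

theorem nodes_subset_ideal (S : T.Subtree) : S.nodes ⊆ (T.ideal S.root).nodes :=
  fun _ hn => S.walk_root (S.t_mem _ hn)

/-- Cuts of a subtree are the subtrees contained in it with the same root. -/
def liftCutEquiv (S : T.Subtree) :
    S.toTree.Cut ≃ {R : T.Subtree // R.root = S.root ∧ R.nodes ⊆ S.nodes} where
  toFun c := ⟨S.lift c.1, congrArg Subtype.val c.2, S.lift_nodes_subset c.1⟩
  invFun R := ⟨S.colift R.1 (Set.mem_of_eq_of_mem R.2.1 S.root_mem) R.2.2, Subtype.ext R.2.1⟩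
  left_inv c := Subtype.ext (S.lift_injective (S.lift_colift _ _ (S.lift_nodes_subset c.1)))
  right_inv R := Subtype.ext (S.lift_colift _ _ R.2.2)

/-- Containment is automatic, since a subtree lies above its own root. Thus cuts of an ideal subtree
are arbitrary subtrees with the given root. -/
theorem root_eq_iff_ideal (f : T.A) (R : T.Subtree) :
    (R.root = (T.ideal f).root ∧ R.nodes ⊆ (T.ideal f).nodes) ↔ R.root = f :=
  ⟨fun h => h.1, fun h => ⟨h, by subst h; exact R.nodes_subset_ideal⟩⟩

/-! ### Refining a cut above its leaves -/

section Refine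

variable (c : T.Cut)

/-- The first step of a nontrivial walk would pass through a node of `c`; by induction the output of
that node is the leaf `e`, which is impossible. -/
theorem eq_of_walk_leaf {e a : T.A} (he : e ∈ c.1.leaves) (ha : a ∈ c.1.edges)
    (h : Relation.ReflTransGen T.Step a e) : a = e := by
  induction h using Relation.ReflTransGen.head_induction_on with
  | refl => rfl
  | head had _ ih =>
    obtain ⟨m, rfl, rfl⟩ := had
    have hm := c.1.p_mem_of_step ha ((T.s_ne_root m).trans_eq c.2.symm)
    exact absurd (ih (c.1.t_mem _ hm)) (he.2 _ hm)

/-- Walks are deterministic, so two leaves below the same edge are comparable, and comparable leaves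
of a cut coincide. -/
theorem leaf_unique {e e' a : T.A} (he : e ∈ c.1.leaves) (he' : e' ∈ c.1.leaves)
    (h : Relation.ReflTransGen T.Step a e) (h' : Relation.ReflTransGen T.Step a e') : e = e' := by
  rcases Relation.ReflTransGen.total_of_right_unique T.step_rightUnique h h' with h | h
  · exact eq_of_walk_leaf c he' he.1 h
  · exact (eq_of_walk_leaf c he he'.1 h).symm

theorem not_walk_leaf {e : T.A} {n : T.N} (he : e ∈ c.1.leaves) (hn : n ∈ c.1.nodes) :
    ¬ Relation.ReflTransGen T.Step (T.t n) e := fun h =>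
  he.2 n hn (eq_of_walk_leaf c he (c.1.t_mem n hn) h)

/-- With `not_walk_leaf` and `leaf_unique`, this splits the nodes of the tree into those of `c` and,
for each leaf of `c`, those above it. -/
theorem output_or_walk_leaf (a : T.A) :
    (∃ n ∈ c.1.nodes, T.t n = a) ∨ ∃ e ∈ c.1.leaves, Relation.ReflTransGen T.Step a e := by
  have key : ∀ a ∈ c.1.edges, (∃ n ∈ c.1.nodes, T.t n = a) ∨
      ∃ e ∈ c.1.leaves, Relation.ReflTransGen T.Step a e := fun a ha => by
    by_cases h : ∃ n ∈ c.1.nodes, T.t n = a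
    · exact .inl h
    · exact .inr ⟨a, ⟨ha, fun n hn hna => h ⟨n, hn, hna⟩⟩, .refl⟩
  have h := T.walk a
  induction h using Relation.ReflTransGen.head_induction_on with
  | refl => exact key _ (Set.mem_of_eq_of_mem c.2.symm c.1.root_mem)
  | head had _ ih =>
    rcases ih with ⟨n, hn, hnd⟩ | ⟨e, he, h⟩
    -- The next edge down is the output of a node of `c`; by injectivity of `t` the present edge is
    -- an input of that same node, hence an edge of `c`.
    · obtain ⟨m, rfl, hm⟩ := had
      refine key _ (c.1.s_mem ?_).1
      rwa [← T.t_injective (hnd.trans hm.symm)]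
    · exact .inr ⟨e, he, .head had h⟩

/-- The subtree obtained from a cut by grafting subtrees onto all its leaves. -/
def refine (r : ∀ e : c.1.leaves, {R : T.Subtree // R.root = e.1}) : T.Subtree where
  edges := c.1.edges ∪ ⋃ e, (r e).1.edges
  nodes := c.1.nodes ∪ ⋃ e, (r e).1.nodes
  root := c.1.root
  root_mem := .inl c.1.root_mem
  t_mem n hn := by
    rcases hn with hn | hn
    · exact .inl (c.1.t_mem n hn)
    · obtain ⟨e, hn⟩ := Set.mem_iUnion.1 hn
      exact .inr (Set.mem_iUnion.2 ⟨e, (r e).1.t_mem n hn⟩)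
  image_s := by
    ext a
    constructor
    · rintro ⟨m, hm, rfl⟩
      refine ⟨?_, (T.s_ne_root m).trans_eq c.2.symm⟩
      rcases hm with hm | hm
      · exact .inl (c.1.s_mem hm).1
      · obtain ⟨e, hm⟩ := Set.mem_iUnion.1 hm
        exact .inr (Set.mem_iUnion.2 ⟨e, ((r e).1.s_mem hm).1⟩)
    · rintro ⟨ha, hne⟩
      obtain ⟨m, rfl⟩ := T.exists_s_eq fun h => hne (h.trans c.2.symm)
      refine ⟨m, ?_, rfl⟩
      by_cases hc : T.s m ∈ c.1.edges
      · exact .inl (c.1.p_mem_of_step hc hne)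
      -- Outside `c` the edge cannot be the root of its grafted subtree, because that root is a leaf
      -- of `c`.
      · obtain ⟨e, he⟩ := Set.mem_iUnion.1 (ha.resolve_left hc)
        refine .inr (Set.mem_iUnion.2 ⟨e, (r e).1.p_mem_of_step he fun h => hc ?_⟩)
        rw [h, (r e).2]
        exact e.2.1

/-- A cut finer than `c`. -/
abbrev FinerCut : Type := {d : T.Subtree // d.root = T.root ∧ c.1.nodes ⊆ d.nodes}

namespace FinerCut

variable {c} (d : FinerCut c)

theorem edges_subset : c.1.edges ⊆ d.1.edges :=
  Subtree.edges_subset (Set.mem_of_eq_of_mem (c.2.trans d.2.1.symm) d.1.root_mem) d.2.2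

/-- The part of a finer cut above a leaf of the original cut. -/
def aboveLeaf (e : c.1.leaves) : {R : T.Subtree // R.root = e.1} :=
  ⟨d.1.above ⟨e.1, d.edges_subset e.2.1⟩, rfl⟩

/-- A finer cut is `c` plus independent choices of a subtree at each leaf of `c`. This is the
combinatorial core of coassociativity. -/
theorem aboveLeaf_bijective :
    Function.Bijective (aboveLeaf : FinerCut c → ∀ e : c.1.leaves, {R : T.Subtree // R.root = e.1}) := by
  constructor
  · have key : ∀ d d' : FinerCut c, aboveLeaf d = aboveLeaf d' → d.1.nodes ⊆ d'.1.nodes := by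
      intro d d' h n hn
      rcases output_or_walk_leaf c (T.t n) with ⟨n', hn', h'⟩ | ⟨e, he, h'⟩
      · exact d'.2.2 (T.t_injective h' ▸ hn')
      · have : n ∈ (aboveLeaf d ⟨e, he⟩).1.nodes := (mem_above_nodes _ _).2 ⟨hn, h'⟩
        rw [h] at this
        exact this.1
    intro d d' h
    exact Subtype.ext (ext_nodes (d.2.1.trans d'.2.1.symm)
      ((key d d' h).antisymm (key d' d h.symm)))
  · intro r
    refine ⟨⟨refine c r, c.2, Set.subset_union_left⟩, funext fun e => Subtype.ext ?_⟩
    refine ext_nodes (r e).2.symm (Set.ext fun n => (mem_above_nodes _ _).trans ⟨?_, ?_⟩)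
    · rintro ⟨hn | hn, h⟩
      · exact absurd h (not_walk_leaf c e.2 hn)
      · obtain ⟨e', hn⟩ := Set.mem_iUnion.1 hn
        -- A node grafted at `e'` that also lies above `e` forces `e = e'`, so the grafted subtrees
        -- do not interfere.
        have h' := (r e').1.nodes_subset_ideal hn
        rw [(r e').2] at h'
        rwa [Subtype.ext (leaf_unique c e.2 e'.2 h h')]
    · intro hn
      have h' := (r e).1.nodes_subset_ideal hn
      rw [(r e).2] at h'
      exact ⟨.inr (Set.mem_iUnion.2 ⟨e, hn⟩), h'⟩

/-- A node of `d` with output `a` would itself lie above `e`, so it would already belong to the part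
above `e`. -/
theorem leaf_of_aboveLeaf {e : c.1.leaves} {a : T.A} (ha : a ∈ (d.aboveLeaf e).1.leaves) :
    a ∈ d.1.leaves := by
  have h := (mem_above_edges _ _).1 ha.1
  refine ⟨h.1, fun n hn hna => ha.2 n ((mem_above_nodes _ _).2 ⟨hn, ?_⟩) hna⟩
  rw [hna]
  exact h.2

/-- Each leaf of `d` lies above exactly one leaf of `c`: it is not the output of a node of `c`, as
those are nodes of `d`. -/
theorem leaves_bijective : Function.Bijective
    fun x : Σ e : c.1.leaves, (d.aboveLeaf e).1.leaves =>
      (⟨x.2.1, d.leaf_of_aboveLeaf x.2.2⟩ : d.1.leaves) := by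
  constructor
  · rintro ⟨e, a, ha⟩ ⟨e', a', ha'⟩ h
    obtain rfl : a = a' := congrArg Subtype.val h
    obtain rfl : e = e' := Subtype.ext (leaf_unique c e.2 e'.2
      ((mem_above_edges _ _).1 ha.1).2 ((mem_above_edges _ _).1 ha'.1).2)
    rfl
  · rintro ⟨a, ha⟩
    rcases output_or_walk_leaf c a with ⟨n, hn, h⟩ | ⟨e, he, h⟩
    · exact absurd h (ha.2 n (d.2.2 hn))
    · exact ⟨⟨⟨e, he⟩, a, (mem_above_edges _ _).2 ⟨ha.1, h⟩,
        fun n hn => ha.2 n ((mem_above_nodes _ _).1 hn).1⟩, rfl⟩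

end FinerCut

end Refine

end Subtree

end OpTree

/-! ### Cut sums of subtrees -/

noncomputable instance (T : OpTree) : Fintype T.Subtree := Fintype.ofFinite _

noncomputable instance {T : OpTree} (S : T.Subtree) : Fintype S.leaves := Fintype.ofFinite _

theorem Finset.prod_tmul {R A B ι : Type*} [CommRing R] [CommRing A] [CommRing B] [Algebra R A]
    [Algebra R B] (s : Finset ι) (f : ι → A) (g : ι → B) :
    ∏ i ∈ s, f i ⊗ₜ[R] g i = (∏ i ∈ s, f i) ⊗ₜ[R] ∏ i ∈ s, g i := by
  classical
  induction s using Finset.induction_on with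
  | empty => rfl
  | insert i s hi ih => simp only [Finset.prod_insert hi, ih, Algebra.TensorProduct.tmul_mul_tmul]

namespace PTree

variable {P : PolyEndo.{v, u}}

/-- A subtree of a subtree has the same decorations as the corresponding subtree of the
whole tree. -/
def restrictRestrictIso (X : PTree P) (S : X.tree.Subtree) (R : S.toTree.Subtree) :
    Iso ((X.restrict S).restrict R) (X.restrict (S.lift R)) where
  base :=
    { onA := ⟨fun a => ⟨(show S.edges from a.1).1, a.1.2, a.2⟩,
        fun a => ⟨⟨a.1, a.2.1⟩, a.2.2⟩, fun _ => rfl, fun _ => rfl⟩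
      onM := ⟨fun m => ⟨(show X.tree.p ⁻¹' S.nodes from m.1).1, m.1.2, m.2⟩,
        fun m => ⟨⟨m.1, m.2.1⟩, m.2.2⟩, fun _ => rfl, fun _ => rfl⟩
      onN := ⟨fun n => ⟨(show S.nodes from n.1).1, n.1.2, n.2⟩,
        fun n => ⟨⟨n.1, n.2.1⟩, n.2.2⟩, fun _ => rfl, fun _ => rfl⟩
      comm_s := fun _ => rfl
      comm_p := fun _ => rfl
      comm_t := fun _ => rfl }
  decA h := eqToHom (congrArg X.edgeDec (congrArg Subtype.val h))
  decM h := eqToHom (congrArg X.inputDec (congrArg Subtype.val h))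
  decN h := eqToHom (congrArg X.nodeDec (congrArg Subtype.val h))
  comm_s h _ := by
    cases h
    exact (Category.id_comp _).trans
      ((Category.comp_id _).symm.trans (congrArg (_ ≫ ·) (P.s.map_id _).symm))
  comm_p h _ := by
    cases h
    exact (congrArg (· ≫ _) (P.p.map_id _)).trans
      ((Category.id_comp _).trans (Category.comp_id _).symm)
  comm_t h _ := by
    cases h
    exact (Category.id_comp _).trans
      ((Category.comp_id _).symm.trans (congrArg (_ ≫ ·) (P.t.map_id _).symm))

/-- A `P`-tree is isomorphic to its restriction to a subtree containing everything. -/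
def isoRestrict (X : PTree P) (S : X.tree.Subtree) (hA : ∀ a, a ∈ S.edges)
    (hN : ∀ n, n ∈ S.nodes) : Iso X (X.restrict S) where
  base :=
    { onA := (Equiv.subtypeUnivEquiv hA).symm
      onM := (Equiv.subtypeUnivEquiv fun m => hN (X.tree.p m)).symm
      onN := (Equiv.subtypeUnivEquiv hN).symm
      comm_s := fun _ => rfl
      comm_p := fun _ => rfl
      comm_t := fun _ => rfl }
  decA h := eqToHom (congrArg X.edgeDec (congrArg Subtype.val h))
  decM h := eqToHom (congrArg X.inputDec (congrArg Subtype.val h))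
  decN h := eqToHom (congrArg X.nodeDec (congrArg Subtype.val h))
  comm_s h _ := by
    cases h
    exact (Category.id_comp _).trans
      ((Category.comp_id _).symm.trans (congrArg (_ ≫ ·) (P.s.map_id _).symm))
  comm_p h _ := by
    cases h
    exact (congrArg (· ≫ _) (P.p.map_id _)).trans
      ((Category.id_comp _).trans (Category.comp_id _).symm)
  comm_t h _ := by
    cases h
    exact (Category.id_comp _).trans
      ((Category.comp_id _).symm.trans (congrArg (_ ≫ ·) (P.t.map_id _).symm))

theorem gen_restrict_restrict (X : PTree P) (S : X.tree.Subtree) (R : S.toTree.Subtree) :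
    ((X.restrict S).restrict R).gen = (X.restrict (S.lift R)).gen :=
  gen_eq_of_iso (X.restrictRestrictIso S R)

/-- The forest of ideal subtrees generated by the leaves of a subtree. -/
noncomputable def pruning (X : PTree P) (S : X.tree.Subtree) : TreeAlg P :=
  ∏ e : S.leaves, (X.restrict (X.tree.ideal e.1)).gen

open Classical in
theorem cutSum_eq (X : PTree P) :
    X.cutSum = ∑ c : X.tree.Cut, X.pruning c.1 ⊗ₜ[ℚ] (X.restrict c.1).gen := by
  unfold cutSum pruning
  exact Finset.sum_congr (Finset.ext fun _ => by simp only [Finset.mem_univ]) fun _ _ => rfl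

-- Moves the coproduct of a restricted tree into subtrees of the one ambient tree, where the two
-- iterated coproducts can be compared.
open Classical in
theorem cutSum_restrict (X : PTree P) (S : X.tree.Subtree) :
    (X.restrict S).cutSum =
      ∑ R : {R : X.tree.Subtree // R.root = S.root ∧ R.nodes ⊆ S.nodes},
        (∏ e : R.1.leaves, (X.restrict (S.above ⟨e.1, R.1.edges_subset
          (Set.mem_of_eq_of_mem R.2.1 S.root_mem) R.2.2 e.2.1⟩)).gen) ⊗ₜ[ℚ]
        (X.restrict R.1).gen := by
  rw [cutSum_eq]
  refine Fintype.sum_equiv S.liftCutEquiv _ _ fun c => ?_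
  congr 1
  · exact Fintype.prod_equiv (S.liftLeavesEquiv c.1) _ _ fun e => X.gen_restrict_restrict S _
  · exact X.gen_restrict_restrict S c.1

open Classical in
theorem cutSum_restrict_ideal (X : PTree P) (f : X.tree.A) :
    (X.restrict (X.tree.ideal f)).cutSum =
      ∑ R : {R : X.tree.Subtree // R.root = f}, X.pruning R.1 ⊗ₜ[ℚ] (X.restrict R.1).gen := by
  rw [cutSum_restrict]
  refine Fintype.sum_equiv
    (Equiv.subtypeEquivRight fun R => OpTree.Subtree.root_eq_iff_ideal f R) _ _ fun R => ?_
  congr 1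
  refine Fintype.prod_congr _ _ fun e => ?_
  rw [OpTree.Subtree.above_ideal]

theorem pruning_finerCut (X : PTree P) {c : X.tree.Cut} (d : OpTree.Subtree.FinerCut c) :
    X.pruning d.1 = ∏ e, X.pruning (d.aboveLeaf e).1 := by
  unfold pruning
  rw [← Fintype.prod_sigma']
  exact (Fintype.prod_bijective _ d.leaves_bijective _ _ fun _ => rfl).symm

-- Distributivity turns the product over leaves into a sum over families of subtrees, one rooted at
-- each leaf; these families are reindexed by finer cuts.
open Classical in
theorem prod_cutSum_leaves (X : PTree P) (c : X.tree.Cut) :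
    ∏ e : c.1.leaves, (X.restrict (X.tree.ideal e.1)).cutSum =
      ∑ d : OpTree.Subtree.FinerCut c, X.pruning d.1 ⊗ₜ[ℚ]
        ∏ e, (X.restrict (d.aboveLeaf e).1).gen := by
  simp_rw [cutSum_restrict_ideal, Finset.prod_univ_sum, Fintype.piFinset_univ]
  refine (Fintype.sum_bijective _ OpTree.Subtree.FinerCut.aboveLeaf_bijective _ _ fun d => ?_).symm
  rw [pruning_finerCut]
  exact (Finset.prod_tmul _ _ _).symm

end PTree

/-! ### The bialgebra axioms -/

namespace OpTree

/-- The cut consisting of the root only. -/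
def rootCut (T : OpTree) : T.Cut :=
  ⟨{ edges := {T.root}
     nodes := ∅
     root := T.root
     root_mem := rfl
     t_mem := fun _ h => h.elim
     image_s := by simp }, rfl⟩

/-- The cut consisting of the whole tree. -/
def totalCut (T : OpTree) : T.Cut := ⟨T.ideal T.root, rfl⟩

theorem totalCut_nodes (T : OpTree) (n : T.N) : n ∈ T.totalCut.1.nodes :=
  T.walk _

theorem totalCut_edges (T : OpTree) (a : T.A) : a ∈ T.totalCut.1.edges :=
  T.walk _

end OpTree

namespace PTree

variable {P : PolyEndo.{v, u}}

theorem counitValue_of_isEmpty (X : PTree P) (h : IsEmpty X.tree.N) :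
    X.counitValue = 1 := if_pos h

theorem counitValue_of_node (X : PTree P) (n : X.tree.N) :
    X.counitValue = 0 := if_neg fun h => h.elim n

end PTree

namespace TreeAlg

variable {P : PolyEndo.{v, u}}

theorem algHom_ext {A : Type*} [CommRing A] [Algebra ℚ A] {f g : TreeAlg P →ₐ[ℚ] A}
    (h : ∀ X : PTree P, f X.gen = g X.gen) : f = g :=
  MvPolynomial.algHom_ext fun i => Quotient.inductionOn i h

theorem comulHom_gen (X : PTree P) : comulHom P X.gen = X.cutSum :=
  MvPolynomial.aeval_X _ _

theorem counitHom_gen (X : PTree P) : counitHom P X.gen = X.counitValue :=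
  MvPolynomial.aeval_X _ _

theorem comulHom_pruning (X : PTree P) (S : X.tree.Subtree) :
    comulHom P (X.pruning S) = ∏ e : S.leaves, (X.restrict (X.tree.ideal e.1)).cutSum := by
  unfold PTree.pruning
  rw [map_prod]
  simp_rw [comulHom_gen]

theorem coassoc_gen (X : PTree P) :
    Algebra.TensorProduct.assoc ℚ ℚ ℚ (TreeAlg P) (TreeAlg P) (TreeAlg P)
      (Algebra.TensorProduct.map (comulHom P) (.id ℚ (TreeAlg P)) X.cutSum) =
    Algebra.TensorProduct.map (.id ℚ (TreeAlg P)) (comulHom P) X.cutSum := by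
  classical
  -- The common summand for a nested pair. The case distinction only supplies the proof that leaves
  -- of `c` are edges of `d`; the value `0` is never used for nested cuts.
  let F (c d : X.tree.Subtree) : TreeAlg P ⊗[ℚ] (TreeAlg P ⊗[ℚ] TreeAlg P) :=
    if h : c.root ∈ d.edges ∧ c.nodes ⊆ d.nodes then
      X.pruning d ⊗ₜ[ℚ] ((∏ e : c.leaves, (X.restrict (d.above ⟨e.1,
        c.edges_subset h.1 h.2 e.2.1⟩)).gen) ⊗ₜ[ℚ] (X.restrict c).gen)
    else 0
  have hl : ∀ c : X.tree.Cut,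
      Algebra.TensorProduct.assoc ℚ ℚ ℚ (TreeAlg P) (TreeAlg P) (TreeAlg P)
        (Algebra.TensorProduct.map (comulHom P) (.id ℚ (TreeAlg P))
          (X.pruning c.1 ⊗ₜ[ℚ] (X.restrict c.1).gen)) =
      ∑ d : X.tree.Cut, if c.1.nodes ⊆ d.1.nodes then F c.1 d.1 else 0 := by
    intro c
    rw [Algebra.TensorProduct.map_tmul, comulHom_pruning, X.prod_cutSum_leaves,
      TensorProduct.sum_tmul, map_sum, ← Finset.sum_filter]
    refine Finset.sum_bij (fun d _ => ⟨d.1, d.2.1⟩)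
      (fun d _ => Finset.mem_filter.2 ⟨Finset.mem_univ _, d.2.2⟩)
      (fun d _ d' _ h => Subtype.ext (congrArg (fun x : X.tree.Cut => x.1) h))
      (fun d hd => ⟨⟨d.1, d.2, (Finset.mem_filter.1 hd).2⟩, Finset.mem_univ _, rfl⟩)
      fun d _ => ?_
    have h : c.1.root ∈ d.1.edges ∧ c.1.nodes ⊆ d.1.nodes :=
      ⟨d.edges_subset c.1.root_mem, d.2.2⟩
    simp only [F, dif_pos h]
    rfl
  have hr : ∀ d : X.tree.Cut,
      Algebra.TensorProduct.map (.id ℚ (TreeAlg P)) (comulHom P)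
          (X.pruning d.1 ⊗ₜ[ℚ] (X.restrict d.1).gen) =
      ∑ c : X.tree.Cut, if c.1.nodes ⊆ d.1.nodes then F c.1 d.1 else 0 := by
    intro d
    rw [Algebra.TensorProduct.map_tmul, comulHom_gen, X.cutSum_restrict,
      TensorProduct.tmul_sum, ← Finset.sum_filter]
    refine Finset.sum_bij (fun c _ => ⟨c.1, c.2.1.trans d.2⟩)
      (fun c _ => Finset.mem_filter.2 ⟨Finset.mem_univ _, c.2.2⟩)
      (fun c _ c' _ h => Subtype.ext (congrArg (fun x : X.tree.Cut => x.1) h))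
      (fun c hc => ⟨⟨c.1, c.2.trans d.2.symm, (Finset.mem_filter.1 hc).2⟩,
        Finset.mem_univ _, rfl⟩)
      fun c _ => ?_
    have h : c.1.root ∈ d.1.edges ∧ c.1.nodes ⊆ d.1.nodes :=
      ⟨Set.mem_of_eq_of_mem c.2.1 d.1.root_mem, c.2.2⟩
    simp only [F, dif_pos h]
    rfl
  rw [X.cutSum_eq, map_sum, map_sum, map_sum, Finset.sum_congr rfl fun c _ => hl c,
    Finset.sum_congr rfl fun c _ => hr c]
  -- Both sides now sum `F` over nested pairs of cuts, in opposite orders.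
  exact Finset.sum_comm

/-! ### Counitality -/

theorem counit_pruning_totalCut (X : PTree P) :
    counitHom P (X.pruning X.tree.totalCut.1) = 1 := by
  unfold PTree.pruning
  rw [map_prod]
  refine Finset.prod_eq_one fun e _ => ?_
  rw [counitHom_gen]
  refine PTree.counitValue_of_isEmpty _ ⟨fun ⟨n, hn⟩ => ?_⟩
  exact OpTree.Subtree.not_walk_leaf X.tree.totalCut e.2 (X.tree.totalCut_nodes n) hn

/-- A node missing from `c` lies above some leaf, and the corresponding pruned tree has counit zero.
-/
theorem counit_pruning_of_ne (X : PTree P) {c : X.tree.Cut} (h : c ≠ X.tree.totalCut) :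
    counitHom P (X.pruning c.1) = 0 := by
  have : ∃ n, n ∉ c.1.nodes := by
    by_contra! hc
    exact h (Subtype.ext (OpTree.Subtree.ext_nodes c.2
      (Set.ext fun n => ⟨fun _ => X.tree.totalCut_nodes n, fun _ => hc n⟩)))
  obtain ⟨n, hn⟩ := this
  obtain ⟨n', hn', h'⟩ | ⟨e, he, h'⟩ := OpTree.Subtree.output_or_walk_leaf c (X.tree.t n)
  · exact absurd (X.tree.t_injective h' ▸ hn') hn
  · unfold PTree.pruning
    rw [map_prod]
    refine Finset.prod_eq_zero (Finset.mem_univ ⟨e, he⟩) ?_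
    rw [counitHom_gen]
    exact PTree.counitValue_of_node _ ⟨n, h'⟩

/-- The root is the only leaf, and everything lies above it. -/
theorem pruning_rootCut (X : PTree P) : X.pruning X.tree.rootCut.1 = X.gen := by
  unfold PTree.pruning
  have hr : X.tree.root ∈ X.tree.rootCut.1.leaves := ⟨rfl, fun _ h => h.elim⟩
  rw [Fintype.prod_eq_single ⟨X.tree.root, hr⟩ fun e he => absurd (Subtype.ext e.2.1) he]
  exact (PTree.gen_eq_of_iso
    (X.isoRestrict _ X.tree.totalCut_edges X.tree.totalCut_nodes)).symm

theorem counit_restrict_rootCut (X : PTree P) :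
    counitHom P (X.restrict X.tree.rootCut.1).gen = 1 := by
  rw [counitHom_gen]
  exact PTree.counitValue_of_isEmpty _ ⟨fun n => n.2⟩

theorem counit_restrict_of_ne (X : PTree P) {c : X.tree.Cut} (h : c ≠ X.tree.rootCut) :
    counitHom P (X.restrict c.1).gen = 0 := by
  rw [counitHom_gen]
  by_cases hc : c.1.nodes = ∅
  · exact absurd (Subtype.ext (OpTree.Subtree.ext_nodes c.2 hc)) h
  · obtain ⟨n, hn⟩ := Set.nonempty_iff_ne_empty.2 hc
    exact PTree.counitValue_of_node _ ⟨n, hn⟩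

theorem rTensor_counit_gen (X : PTree P) :
    Algebra.TensorProduct.map (counitHom P) (.id ℚ (TreeAlg P)) X.cutSum = 1 ⊗ₜ[ℚ] X.gen := by
  classical
  rw [X.cutSum_eq, map_sum, Fintype.sum_eq_single X.tree.totalCut fun c hc => ?_]
  · rw [Algebra.TensorProduct.map_tmul, counit_pruning_totalCut, PTree.gen_eq_of_iso
      (X.isoRestrict _ X.tree.totalCut_edges X.tree.totalCut_nodes)]
    rfl
  · rw [Algebra.TensorProduct.map_tmul, counit_pruning_of_ne X hc, TensorProduct.zero_tmul]

theorem lTensor_counit_gen (X : PTree P) :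
    Algebra.TensorProduct.map (.id ℚ (TreeAlg P)) (counitHom P) X.cutSum = X.gen ⊗ₜ[ℚ] 1 := by
  classical
  rw [X.cutSum_eq, map_sum, Fintype.sum_eq_single X.tree.rootCut fun c hc => ?_]
  · rw [Algebra.TensorProduct.map_tmul, counit_restrict_rootCut, pruning_rootCut]
    rfl
  · rw [Algebra.TensorProduct.map_tmul, counit_restrict_of_ne X hc, TensorProduct.tmul_zero]

variable (P) in
theorem isBialgebra : IsBialgebra P := by
  let b : Bialgebra ℚ (TreeAlg P) := Bialgebra.ofAlgHom (comulHom P) (counitHom P)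
    (algHom_ext fun X => by
      simp only [AlgHom.comp_apply, comulHom_gen]
      exact coassoc_gen X)
    (algHom_ext fun X => by
      simp only [AlgHom.comp_apply, comulHom_gen]
      exact rTensor_counit_gen X)
    (algHom_ext fun X => by
      simp only [AlgHom.comp_apply, comulHom_gen]
      exact lTensor_counit_gen X)
  exact ⟨b.toCoalgebra, rfl⟩

end TreeAlg

/-! ### Redecoration -/

namespace CartMor

variable {P' : PolyEndo.{v', u'}} {P : PolyEndo.{v, u}} (u : CartMor P' P)

/-- Redecoration of an isomorphism of trees. -/
def redecorateIso {X Y : PTree P'} (f : PTree.Iso X Y) :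
    PTree.Iso (u.redecorate X) (u.redecorate Y) where
  base := f.base
  decA h := u.onI.map (f.decA h)
  decM h := u.onE.map (f.decM h)
  decN h := u.onB.map (f.decN h)
  comm_s {m m'} h h' := by
    have hn := u.sqS.hom.naturality (f.decM h)
    simp only [Functor.comp_map] at hn
    simp only [redecorate, ← Functor.map_comp_assoc]
    rw [f.comm_s h h', Functor.map_comp_assoc, hn, Category.assoc]
  comm_p {m m'} h h' := by
    have hn := u.sqP.hom.naturality (f.decM h)
    simp only [Functor.comp_map] at hn
    change P.p.map (u.onE.map (f.decM h)) ≫ u.sqP.hom.app _ ≫ u.onB.map _ =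
      (u.sqP.hom.app _ ≫ u.onB.map _) ≫ u.onB.map _
    rw [← Category.assoc, hn, Category.assoc, Category.assoc, ← Functor.map_comp]
    exact congrArg (_ ≫ ·) ((congrArg u.onB.map (f.comm_p h h')).trans (u.onB.map_comp _ _))
  comm_t {n n'} h h' := by
    have hn := u.sqT.hom.naturality (f.decN h)
    simp only [Functor.comp_map] at hn
    simp only [redecorate, ← Functor.map_comp_assoc]
    rw [f.comm_t h h', Functor.map_comp_assoc, hn, Category.assoc]

/-- Redecoration of isomorphism classes of trees. -/
def onClass : TreeClass P' → TreeClass P :=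
  Quotient.map u.redecorate fun _ _ ⟨f⟩ => ⟨u.redecorateIso f⟩

/-- The algebra homomorphism given by redecoration of trees. -/
noncomputable def onAlg : TreeAlg P' →ₐ[ℚ] TreeAlg P :=
  MvPolynomial.rename u.onClass

theorem onAlg_gen (X : PTree P') : u.onAlg X.gen = (u.redecorate X).gen :=
  MvPolynomial.rename_X _ _

/-- Redecoration keeps the underlying tree and commutes with restriction definitionally, so the two
products match factor by factor. -/
theorem onAlg_pruning (X : PTree P') (S : X.tree.Subtree) :
    u.onAlg (X.pruning S) = (u.redecorate X).pruning S := by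
  unfold PTree.pruning
  rw [map_prod]
  exact Fintype.prod_congr _ _ fun e => u.onAlg_gen _

theorem map_onAlg_cutSum (X : PTree P') :
    Algebra.TensorProduct.map u.onAlg u.onAlg X.cutSum = (u.redecorate X).cutSum := by
  classical
  rw [PTree.cutSum_eq, PTree.cutSum_eq, map_sum]
  refine Fintype.sum_congr _ _ fun c => ?_
  rw [Algebra.TensorProduct.map_tmul, onAlg_pruning, onAlg_gen]
  rfl

/-- The bialgebra homomorphism given by redecoration of trees. -/
noncomputable def onBialg : TreeAlg P' →ₐc[ℚ] TreeAlg P where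
  __ := u.onAlg
  map_smul' := map_smul u.onAlg
  counit_comp := by
    have h : (TreeAlg.counitHom P).comp u.onAlg = TreeAlg.counitHom P' :=
      TreeAlg.algHom_ext fun X => by
        rw [AlgHom.comp_apply, onAlg_gen, TreeAlg.counitHom_gen, TreeAlg.counitHom_gen]
        rfl
    exact congrArg AlgHom.toLinearMap h
  map_comp_comul := by
    have h : (Algebra.TensorProduct.map u.onAlg u.onAlg).comp (TreeAlg.comulHom P') =
        (TreeAlg.comulHom P).comp u.onAlg :=
      TreeAlg.algHom_ext fun X => by
        rw [AlgHom.comp_apply, AlgHom.comp_apply, onAlg_gen, TreeAlg.comulHom_gen,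
          TreeAlg.comulHom_gen, map_onAlg_cutSum]
    exact congrArg AlgHom.toLinearMap h

/-- Grafting followed by redecoration is redecoration followed by grafting. -/
noncomputable def redecorateGraftIso {b : P'.B} (F : PForest P') (θ : F.Matching b) :
    PTree.Iso (u.redecorate (F.graft θ))
      ((u.redecorateForest F).graft (u.redecorateMatching θ)) where
  base := ⟨.refl _, .refl _, .refl _, fun _ => rfl, fun _ => rfl, fun _ => rfl⟩
  decA {a a'} h := match a, a', h with
    | none, _, rfl => u.sqT.hom.app b
    | some _, _, rfl => 𝟙 _
  decM {m m'} h := match m, m', h with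
    | .inl k, _, rfl => (u.outHom (θ.equiv k)).left
    | .inr _, _, rfl => 𝟙 _
  decN {n n'} h := match n, n', h with
    | none, _, rfl => 𝟙 _
    | some _, _, rfl => 𝟙 _
  comm_s {m m'} h h' := by
    cases h
    rcases m with k | m
    · refine (Category.id_comp _).trans ?_
      exact (Category.assoc _ _ _).symm
    · exact (Category.id_comp _).trans
        ((Category.comp_id _).symm.trans (congrArg (_ ≫ ·) (P.s.map_id _).symm))
  comm_p {m m'} h h' := by
    cases h
    rcases m with k | m
    · refine Eq.trans ?_ (Category.comp_id _).symm
      -- The triangle over `u.onB.obj b` satisfied by `outHom` is exactly the required square at a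
      -- new input.
      exact CostructuredArrow.w (u.outHom (θ.equiv k))
    · exact (congrArg (· ≫ _) (P.p.map_id _)).trans
        ((Category.id_comp _).trans (Category.comp_id _).symm)
  comm_t {n n'} h h' := by
    cases h
    rcases n with _ | n
    · change u.sqT.hom.app b ≫ 𝟙 _ = (u.onI.map (𝟙 _) ≫ u.sqT.hom.app b) ≫ P.t.map (𝟙 _)
      have h₁ : u.onI.map (𝟙 (P'.t.obj b)) = 𝟙 _ := u.onI.map_id _
      have h₂ : P.t.map (𝟙 (u.onB.obj b)) = 𝟙 _ := P.t.map_id _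
      rw [h₁, h₂]
      exact congrArg (· ≫ _) (Category.id_comp _).symm
    · exact (Category.id_comp _).trans
        ((Category.comp_id _).symm.trans (congrArg (_ ≫ ·) (P.t.map_id _).symm))

/-- On bijections the map is composition with `arityEquiv`; on colour isomorphisms it is `onI.map`
followed by composition with a fixed isomorphism. Both are invertible. -/
theorem redecorateMatching_bijective [u.onI.Full] [u.onI.Faithful] (b : P'.B) (F : PForest P') :
    Function.Bijective
      (u.redecorateMatching : F.Matching b → (u.redecorateForest F).Matching (u.onB.obj b)) := by
  constructor
  · rintro ⟨e, i⟩ ⟨e', i'⟩ h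
    have he : e = e' := Equiv.ext fun k => (u.arityEquiv b).injective
      (DFunLike.congr_fun (congrArg PForest.Matching.equiv h) k)
    subst he
    congr 1
    funext k
    have hk := congrFun (eq_of_heq (PForest.Matching.mk.inj h).2) k
    exact u.onI.map_injective ((cancel_mono _).1 hk)
  · rintro ⟨e, i⟩
    obtain ⟨e, rfl⟩ : ∃ e' : F.ι ≃ P'.Arity b, e'.trans (u.arityEquiv b) = e :=
      ⟨e.trans (u.arityEquiv b).symm, Equiv.ext fun k => (u.arityEquiv b).apply_symm_apply _⟩
    have key (k) : ∃ g : (F.tree k).rootColour ⟶ P'.inColour (e k),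
        u.onI.map g ≫ u.sqS.hom.app (e k).out.left ≫ P.s.map (u.outHom (e k)).left = i k :=
      ⟨u.onI.preimage (i k ≫ inv (u.sqS.hom.app (e k).out.left ≫
        P.s.map (u.outHom (e k)).left)), by
        rw [Functor.map_preimage]
        exact (Category.assoc _ _ _).trans
          ((congrArg (_ ≫ ·) (IsIso.inv_hom_id _)).trans (Category.comp_id _))⟩
    choose g hg using key
    refine ⟨⟨e, g⟩, ?_⟩
    simp only [redecorateMatching]
    congr 1
    exact funext hg

end CartMor

/-! ### The `B_+`-operators -/

namespace PTree.Iso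

variable {P : PolyEndo.{v, u}} {X Y : PTree P}

/-- The isomorphism between the root colours of isomorphic trees. -/
def rootHom (f : Iso X Y) : X.rootColour ⟶ Y.rootColour := f.decA f.base.map_root

end PTree.Iso

/-! ### Invariance of grafting sums under isomorphism of forests -/

namespace PForest

variable {P : PolyEndo.{v, u}}

/-- An isomorphism of forests. -/
structure Iso (F G : PForest P) where
  onι : F.ι ≃ G.ι
  onTree : ∀ k, PTree.Iso (F.tree k) (G.tree (onι k))

namespace Iso

variable {F G : PForest P} (f : Iso F G)

/-- Precomposition of matchings with an isomorphism of forests. -/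
noncomputable def pullMatching {b : P.B} (θ : G.Matching b) : F.Matching b where
  equiv := f.onι.trans θ.equiv
  iso k := (f.onTree k).rootHom ≫ θ.iso (f.onι k)

theorem pullMatching_bijective (b : P.B) :
    Function.Bijective (f.pullMatching : G.Matching b → F.Matching b) := by
  constructor
  · rintro ⟨e, i⟩ ⟨e', i'⟩ h
    have he : e = e' := Equiv.ext fun k => by
      obtain ⟨k, rfl⟩ := f.onι.surjective k
      exact DFunLike.congr_fun (congrArg PForest.Matching.equiv h) k
    subst he
    congr 1
    funext k
    obtain ⟨k, rfl⟩ := f.onι.surjective k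
    exact (cancel_epi _).1 (congrFun (eq_of_heq (PForest.Matching.mk.inj h).2) k)
  · rintro ⟨e, i⟩
    obtain ⟨e, rfl⟩ : ∃ e' : G.ι ≃ P.Arity b, f.onι.trans e' = e :=
      ⟨f.onι.symm.trans e, Equiv.ext fun k => congrArg e (f.onι.symm_apply_apply k)⟩
    -- The given isomorphisms are indexed by `F.ι`, the wanted ones by `G.ι`. Quantifying over all
    -- preimages of `k`, with `eqToHom`, makes the choice of `g` independent of a chosen preimage.
    have key (k) : ∃ g : (G.tree k).rootColour ⟶ P.inColour (e k),
        ∀ k' (h : f.onι k' = k), i k' ≫ eqToHom (congrArg (fun k => P.inColour (e k)) h) =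
          (f.onTree k').rootHom ≫ eqToHom (by rw [h]) ≫ g := by
      obtain ⟨k, rfl⟩ := f.onι.surjective k
      refine ⟨inv (f.onTree k).rootHom ≫ i k, fun k' h => ?_⟩
      obtain rfl := f.onι.injective h
      simp only [eqToHom_refl, Category.id_comp]
      exact (Category.comp_id (i k')).trans (IsIso.hom_inv_id_assoc _ _).symm
    choose g hg using key
    refine ⟨⟨e, g⟩, ?_⟩
    simp only [pullMatching]
    congr 1
    funext k
    have := hg _ k rfl
    simp only [eqToHom_refl, Category.id_comp] at this
    exact this.symm.trans (Category.comp_id _)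

/-- Isomorphic forests have isomorphic underlying trees of their graftings. -/
def graftTree : OpTree.Iso F.graftTree G.graftTree where
  onA := Equiv.optionCongr (f.onι.sigmaCongr fun k => (f.onTree k).base.onA)
  onM := Equiv.sumCongr f.onι (f.onι.sigmaCongr fun k => (f.onTree k).base.onM)
  onN := Equiv.optionCongr (f.onι.sigmaCongr fun k => (f.onTree k).base.onN)
  comm_s := by
    rintro (k | ⟨k, m⟩)
    · exact congrArg (fun a => some (⟨f.onι k, a⟩ : Σ k, (G.tree k).tree.A))
        (f.onTree k).base.map_root
    · exact congrArg (fun a => some (⟨f.onι k, a⟩ : Σ k, (G.tree k).tree.A))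
        ((f.onTree k).base.comm_s m)
  comm_p := by
    rintro (k | ⟨k, m⟩)
    · rfl
    · exact congrArg (fun a => some (⟨f.onι k, a⟩ : Σ k, (G.tree k).tree.N))
        ((f.onTree k).base.comm_p m)
  comm_t := by
    rintro (_ | ⟨k, n⟩)
    · rfl
    · exact congrArg (fun a => some (⟨f.onι k, a⟩ : Σ k, (G.tree k).tree.A))
        ((f.onTree k).base.comm_t n)

/-- The isomorphisms between the decorations of the edges of isomorphic graftings. -/
def graftDecA {b : P.B} (θ : G.Matching b) :
    ∀ {a a'}, f.graftTree.onA a = a' →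
      ((F.graft (f.pullMatching θ)).edgeDec a ⟶ (G.graft θ).edgeDec a')
  | none, _, rfl => 𝟙 (P.t.obj b)
  | some ⟨k, _⟩, _, rfl => (f.onTree k).decA rfl

/-- The isomorphisms between the decorations of the nodes of isomorphic graftings. -/
def graftDecN {b : P.B} (θ : G.Matching b) :
    ∀ {n n'}, f.graftTree.onN n = n' →
      ((F.graft (f.pullMatching θ)).nodeDec n ⟶ (G.graft θ).nodeDec n')
  | none, _, rfl => 𝟙 b
  | some ⟨k, _⟩, _, rfl => (f.onTree k).decN rfl

/-- `graftDecA` computes only at `rfl`, whereas the compatibility squares involve edges equal only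
by the `comm` fields or `map_root`. -/
theorem graftDecA_some {b : P.B} (θ : G.Matching b) {k : F.ι} {a : (F.tree k).tree.A}
    {a' : (G.tree (f.onι k)).tree.A} (e : (f.onTree k).base.onA a = a')
    (h : f.graftTree.onA (some ⟨k, a⟩) = some ⟨f.onι k, a'⟩) :
    f.graftDecA θ h = (f.onTree k).decA e := by
  subst e
  rfl

theorem graftDecN_some {b : P.B} (θ : G.Matching b) {k : F.ι} {n : (F.tree k).tree.N}
    {n' : (G.tree (f.onι k)).tree.N} (e : (f.onTree k).base.onN n = n')
    (h : f.graftTree.onN (some ⟨k, n⟩) = some ⟨f.onι k, n'⟩) :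
    f.graftDecN θ h = (f.onTree k).decN e := by
  subst e
  rfl

/-- Isomorphic forests have isomorphic graftings. -/
noncomputable def graft {b : P.B} (θ : G.Matching b) :
    PTree.Iso (F.graft (f.pullMatching θ)) (G.graft θ) where
  base := f.graftTree
  decA h := f.graftDecA θ h
  decM {m m'} h := match m, m', h with
    | .inl k, _, rfl => 𝟙 (θ.equiv (f.onι k)).out.left
    | .inr ⟨k, _⟩, _, rfl => (f.onTree k).decM rfl
  decN h := f.graftDecN θ h
  comm_s {m m'} h h' := by
    cases h
    rcases m with k | ⟨k, m⟩
    · refine (congrArg (· ≫ _) (f.graftDecA_some θ (f.onTree k).base.map_root h')).trans ?_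
      exact (Category.comp_id _).symm.trans (congrArg (_ ≫ ·) (P.s.map_id _).symm)
    · refine (congrArg (· ≫ _) (f.graftDecA_some θ ((f.onTree k).base.comm_s m) h')).trans ?_
      exact (f.onTree k).comm_s rfl ((f.onTree k).base.comm_s m)
  comm_p {m m'} h h' := by
    cases h
    rcases m with k | ⟨k, m⟩
    · exact (congrArg (· ≫ _) (P.p.map_id _)).trans
        ((Category.id_comp _).trans (Category.comp_id _).symm)
    · refine Eq.trans ?_
        (congrArg (_ ≫ ·) (f.graftDecN_some θ ((f.onTree k).base.comm_p m) h')).symm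
      exact (f.onTree k).comm_p rfl ((f.onTree k).base.comm_p m)
  comm_t {n n'} h h' := by
    cases h
    rcases n with _ | ⟨k, n⟩
    · exact (Category.id_comp _).trans
        ((Category.comp_id _).symm.trans (congrArg (_ ≫ ·) (P.t.map_id _).symm))
    · refine (congrArg (· ≫ _) (f.graftDecA_some θ ((f.onTree k).base.comm_t n) h')).trans ?_
      exact (f.onTree k).comm_t rfl ((f.onTree k).base.comm_t n)

theorem graftSum_eq (f : Iso F G) (b : P.B) : F.graftSum b = G.graftSum b :=
  (finsum_eq_of_bijective _ (f.pullMatching_bijective b) fun θ =>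
    (PTree.gen_eq_of_iso (f.graft θ)).symm).symm

end Iso

/-- `ofMonomial` chooses an ordering of the factors and a representative of each class. Another
listing differs by a permutation, and representatives of equal classes are isomorphic. -/
theorem nonempty_iso_ofMonomial (F : PForest P) {m : TreeClass P →₀ ℕ} {l : List (TreeClass P)}
    (hl : (l : Multiset (TreeClass P)) = Finsupp.toMultiset m) (e : F.ι ≃ Fin l.length)
    (he : ∀ k, (Quotient.mk _ (F.tree k) : TreeClass P) = l.get (e k)) :
    Nonempty (Iso F (ofMonomial m)) := by
  classical
  have hp : l.Perm (Finsupp.toMultiset m).toList :=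
    Multiset.coe_eq_coe.1 (hl.trans (Multiset.coe_toList _).symm)
  let e' : F.ι ≃ (ofMonomial m).ι := e.trans
    ⟨hp.idxBij, hp.symm.idxBij, hp.symm.idxBij_leftInverse_idxBij_symm,
      hp.idxBij_leftInverse_idxBij_symm⟩
  have key (k) : Nonempty (PTree.Iso (F.tree k) ((ofMonomial m).tree (e' k))) := by
    refine Quotient.exact ((he k).trans (Eq.trans ?_ (Quotient.out_eq _).symm))
    exact (hp.getElem_idxBij_eq_getElem _).symm
  exact ⟨⟨e', fun k => (key k).some⟩⟩

instance (F : PForest P) (b : P.B) [∀ i j : P.I, Finite (i ⟶ j)] : Finite (F.Matching b) := by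
  have := P.finite_fibre b
  exact Finite.of_injective (β := Σ e : F.ι ≃ P.Arity b,
      ∀ k, (F.tree k).rootColour ⟶ P.inColour (e k)) (fun θ => ⟨θ.equiv, θ.iso⟩)
    fun ⟨_, _⟩ ⟨_, _⟩ h => by cases h; rfl

end PForest

theorem bPlus_monomial {P : PolyEndo.{v, u}} (b : P.B) (m : TreeClass P →₀ ℕ) :
    bPlus b (MvPolynomial.monomial m 1 : MvPolynomial (TreeClass P) ℚ) =
      (PForest.ofMonomial m).graftSum b := by
  have h := (MvPolynomial.basisMonomials (TreeClass P) ℚ).constr_basis ℚ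
    (fun m => (PForest.ofMonomial m).graftSum b) m
  rwa [MvPolynomial.coe_basisMonomials] at h

/-! ### Redecoration and the `B_+`-operators -/

namespace CartMor

variable {P' : PolyEndo.{v', u'}} {P : PolyEndo.{v, u}} (u : CartMor P' P)

theorem nonempty_redecorateForest_ofMonomial (m : TreeClass P' →₀ ℕ) :
    Nonempty (PForest.Iso (u.redecorateForest (PForest.ofMonomial m))
      (PForest.ofMonomial (m.mapDomain u.onClass))) := by
  refine PForest.nonempty_iso_ofMonomial _ (l := (Finsupp.toMultiset m).toList.map u.onClass) ?_
    (finCongr (List.length_map _).symm) fun k => ?_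
  · rw [← Multiset.map_coe, Multiset.coe_toList, Finsupp.toMultiset_map]
  · have h : u.onClass (Quotient.mk _ ((PForest.ofMonomial m).tree k)) =
        u.onClass ((Finsupp.toMultiset m).toList.get k) :=
      congrArg u.onClass (Quotient.out_eq _)
    exact h.trans (List.getElem_map u.onClass).symm

theorem onAlg_graftSum [u.onI.Full] [u.onI.Faithful] [∀ i j : P.I, Finite (i ⟶ j)]
    (b : P'.B) (F : PForest P') :
    u.onAlg (F.graftSum b) = (u.redecorateForest F).graftSum (u.onB.obj b) := by
  -- Faithfulness transfers finiteness of hom-sets to `P'.I`. The matchings are then finite in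
  -- number, as needed to move the homomorphism inside `finsum`.
  have (i j : P'.I) : Finite (i ⟶ j) := Finite.of_injective _ (u.onI.map_injective (X := i) (Y := j))
  refine (AddMonoidHom.map_finsum (u.onAlg : TreeAlg P' →+ TreeAlg P) (Set.toFinite _)).trans ?_
  refine finsum_eq_of_bijective _ (u.redecorateMatching_bijective b F) fun θ => ?_
  exact (u.onAlg_gen _).trans (PTree.gen_eq_of_iso (u.redecorateGraftIso F θ))

/-- By linearity it suffices to treat monomials. The redecorated representing forest is only
isomorphic to the representing forest of the image monomial, which is enough by `graftSum_eq`. -/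
theorem onAlg_bPlus [u.onI.Full] [u.onI.Faithful] [∀ i j : P.I, Finite (i ⟶ j)]
    (b : P'.B) (x : TreeAlg P') :
    u.onAlg (bPlus b x) = bPlus (u.onB.obj b) (u.onAlg x) := by
  have h : u.onAlg.toLinearMap ∘ₗ bPlus b = bPlus (u.onB.obj b) ∘ₗ u.onAlg.toLinearMap := by
    refine (MvPolynomial.basisMonomials (TreeClass P') ℚ).ext fun m => ?_
    rw [MvPolynomial.coe_basisMonomials]
    have hm : u.onAlg (MvPolynomial.monomial m 1 : MvPolynomial (TreeClass P') ℚ) =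
        (MvPolynomial.monomial (m.mapDomain u.onClass) 1 : MvPolynomial (TreeClass P) ℚ) :=
      MvPolynomial.rename_monomial _ _ _
    change u.onAlg (bPlus b _) = bPlus (u.onB.obj b) (u.onAlg _)
    rw [hm, bPlus_monomial, bPlus_monomial, onAlg_graftSum]
    exact (u.nonempty_redecorateForest_ofMonomial m).some.graftSum_eq _
  exact LinearMap.congr_fun h x

end CartMor

/-- A cartesian morphism of polynomial endofunctors induces, by redecorating trees, a bialgebra
homomorphism, which is compatible with grafting and, if it is fully faithful on colours, with the
`B_+`-operators. -/
theorem mainTheorem4 (P' : PolyEndo.{v', u'}) (P : PolyEndo.{v, u}) (u : CartMor P' P) :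
    TreeAlg.IsBialgebra P' ∧ TreeAlg.IsBialgebra P ∧
    ∃ φ : TreeAlg P' →ₐc[ℚ] TreeAlg P,
      (∀ T : PTree P', φ T.gen = (u.redecorate T).gen) ∧
      (∀ (b' : P'.B) (F : PForest P') (θ : F.Matching b'),
        Nonempty (PTree.Iso (u.redecorate (F.graft θ))
          ((u.redecorateForest F).graft (u.redecorateMatching θ)))) ∧
      (u.onI.Full → u.onI.Faithful →
        (∀ (b' : P'.B) (F : PForest P'), Function.Bijective
          (u.redecorateMatching : F.Matching b' → (u.redecorateForest F).Matching (u.onB.obj b'))) ∧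
        ((∀ i j : P.I, Finite (i ⟶ j)) → ∀ (b' : P'.B) (x : TreeAlg P'),
          φ (bPlus b' x) = bPlus (u.onB.obj b') (φ x))) :=
  ⟨TreeAlg.isBialgebra P', TreeAlg.isBialgebra P, u.onBialg, u.onAlg_gen,
    fun _ F θ => ⟨u.redecorateGraftIso F θ⟩,
    fun _ _ => ⟨u.redecorateMatching_bijective, fun _ => u.onAlg_bPlus⟩⟩
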